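/- A \emph{hexagonal system} is a finite connected plane graph without cut vertices in which every interior face is bounded by a regular hexagon of side length $1$. Let $H$ be a hexagonal system with at least one perfect matching. A \emph{Clar cover} of $H$ is a spanning subgraph of $H$ each connected component of which is either a hexagon or an edge; a \emph{resonant pattern} of $H$ is the set of hexagons of a Clar cover of $H$; and the \emph{Clar number} $C(H)$ is the maximum number of hexagons in a resonant pattern. The \emph{sextet polynomial} of $H$ is $\sum_{k=0}^{C(H)} s(H,k)x^k$, where $s(H,k)$ is the number of resonant patterns of $H$ with precisely $k$ hexagons (so $s(H,0)=1$). \textbf{Theorem.} The set of all real zeros of the sextet polynomials of all hexagonal systems with at least one perfect matching is a dense subset of $(-\infty,0]$; that is, its closure in $\mathbb{R}$ is $(-\infty,0]$. -/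

import Mathlib

/-! Hexagonal systems as straight-line plane graphs, and their sextet polynomials. -/

namespace SextetZeros

variable {V : Type}

/-- The point set of the drawing of `G` in the plane `ℂ`: vertex `v` is drawn at `pos v`, and each
edge as the straight segment between its end points. -/
def drawing (G : SimpleGraph V) (pos : V → ℂ) : Set ℂ :=
  Set.range pos ∪ {z | ∃ u v, G.Adj u v ∧ z ∈ segment ℝ (pos u) (pos v)}

/-- The drawing is a plane graph: distinct vertices are distinct points, no vertex lies in the
relative interior of an edge, and distinct edges meet at most in common end points. -/
structure IsPlane (G : SimpleGraph V) (pos : V → ℂ) : Prop where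
  injective : Function.Injective pos
  vertex_notMem : ∀ u v w, G.Adj u v → pos w ∉ openSegment ℝ (pos u) (pos v)
  disjoint : ∀ u v u' v', G.Adj u v → G.Adj u' v' → s(u, v) ≠ s(u', v') →
    Disjoint (openSegment ℝ (pos u) (pos v)) (openSegment ℝ (pos u') (pos v'))

/-- The interior faces: the bounded connected components of the complement of the drawing. -/
def interiorFaces (G : SimpleGraph V) (pos : V → ℂ) : Set (Set ℂ) :=
  {F | Bornology.IsBounded F ∧
    ∃ z ∈ (drawing G pos)ᶜ, F = connectedComponentIn (drawing G pos)ᶜ z}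

/-- The `k`-th vertex, in counterclockwise order, of the regular hexagon with centre `c` one of
whose vertices is `c + u`; its side length is `‖u‖`. -/
noncomputable def hexVertex (c u : ℂ) (k : Fin 6) : ℂ :=
  c + u * Complex.exp (((k : ℕ) : ℂ) * (Real.pi / 3 * Complex.I))

/-- `h 0, …, h 5` is a 6-cycle of `G` (indices modulo 6) that is drawn, in counterclockwise order,
as a regular hexagon of side length `1`. -/
def IsHexagon (G : SimpleGraph V) (pos : V → ℂ) (h : Fin 6 → V) : Prop :=
  (∃ c u : ℂ, ‖u‖ = 1 ∧ ∀ k, pos (h k) = hexVertex c u k) ∧ ∀ k, G.Adj (h k) (h (k + 1))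

/-- A hexagonal system: a finite connected plane graph without cut vertices in which every
interior face is bounded by a regular hexagon of side length `1`. -/
structure IsHexagonalSystem (G : SimpleGraph V) (pos : V → ℂ) : Prop where
  finite : Finite V
  plane : IsPlane G pos
  connected : G.Connected
  no_cut_vertex : ∀ v, (G.induce {v}ᶜ).Preconnected
  face : ∀ F ∈ interiorFaces G pos, ∃ h : Fin 6 → V, IsHexagon G pos h ∧
    F = interior (convexHull ℝ (Set.range (pos ∘ h)))

/-- The connected component `c` of `C` is a single edge. -/
def IsEdgeComponent (C : SimpleGraph V) (c : C.ConnectedComponent) : Prop :=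
  ∃ u v, C.Adj u v ∧ c.supp = {u, v}

/-- The connected component `c` of `C` is a hexagon: it consists of the six vertices and exactly
the six sides of a hexagon. -/
def IsHexagonComponent (C : SimpleGraph V) (pos : V → ℂ) (c : C.ConnectedComponent) : Prop :=
  ∃ h : Fin 6 → V, IsHexagon C pos h ∧ c.supp = Set.range h ∧
    ∀ i j, C.Adj (h i) (h j) → j = i + 1 ∨ i = j + 1

/-- A Clar cover of `G`: a spanning subgraph `C` (a graph on the same vertices) each connected
component of which is either a hexagon or an edge. -/
def IsClarCover (G : SimpleGraph V) (pos : V → ℂ) (C : SimpleGraph V) : Prop :=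
  C ≤ G ∧ ∀ c : C.ConnectedComponent, IsHexagonComponent C pos c ∨ IsEdgeComponent C c

/-- The set of hexagons of a Clar cover; a hexagon is recorded by its set of vertices. -/
def clarHexagons (C : SimpleGraph V) (pos : V → ℂ) : Set (Set V) :=
  {A | ∃ c : C.ConnectedComponent, IsHexagonComponent C pos c ∧ c.supp = A}

/-- The resonant patterns: the sets of hexagons of Clar covers. -/
def resonantPatterns (G : SimpleGraph V) (pos : V → ℂ) : Set (Set (Set V)) :=
  {K | ∃ C, IsClarCover G pos C ∧ K = clarHexagons C pos}

/-- The Clar number: the maximum number of hexagons in a resonant pattern. -/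
noncomputable def clarNumber (G : SimpleGraph V) (pos : V → ℂ) : ℕ :=
  sSup {k | ∃ K ∈ resonantPatterns G pos, K.ncard = k}

/-- `s(H, k)`: the number of resonant patterns with precisely `k` hexagons. -/
noncomputable def sextetNumber (G : SimpleGraph V) (pos : V → ℂ) (k : ℕ) : ℕ :=
  {K | K ∈ resonantPatterns G pos ∧ K.ncard = k}.ncard

/-- The sextet polynomial `∑_{k = 0}^{C(H)} s(H, k) x ^ k`. -/
noncomputable def sextetPolynomial (G : SimpleGraph V) (pos : V → ℂ) : Polynomial ℝ :=
  ∑ k ∈ Finset.range (clarNumber G pos + 1),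
    Polynomial.C (sextetNumber G pos k : ℝ) * Polynomial.X ^ k

/-- `r` is a real zero of the sextet polynomial of some hexagonal system that has at least one
Kekulé structure (perfect matching). -/
def IsRealSextetZero (r : ℝ) : Prop :=
  ∃ (V : Type) (G : SimpleGraph V) (pos : V → ℂ), IsHexagonalSystem G pos ∧
    (∃ M : G.Subgraph, M.IsPerfectMatching) ∧ (sextetPolynomial G pos).IsRoot r

end SextetZeros

/-!
The sextet polynomial `∑ s(H, k) x ^ k` has nonnegative coefficients, and a perfect matching is a
Clar cover without hexagons, so `s(H, 0) > 0`; hence no zero is positive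
(`IsRealSextetZero.nonpos`).

For the density, consider chains of hexagons whose centres move one column to the right at every
step, up or down according to a word `σ : ℕ → Bool`. Such a chain is a ladder: two paths, one above
the other, joined by rungs. It is a hexagonal system (`chain_isHexagonalSystem`): as the union of
the closed hexagons meets every vertical line in a convex set, a point outside of it escapes to
infinity along a vertical ray, so the only bounded faces are the hexagons. Deleting a vertex of one
side leaves the other side connected, so there is no cut vertex.

The hexagons of the drawing are only the obvious ones (`IsHexagon.exists_range_eq`), as every side
is a sixth root of unity and a pair of opposite horizontal sides determines the hexagon.

Call a hexagon a kink if the chain turns there. The resonant patterns of a chain are the sets of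
hexagons any two of which are separated by a kink strictly between them
(`mem_resonantPatterns_chain`). Between two hexagons of a Clar cover on the same straight segment,
one side of the chain would have to be matched forwards vertex by vertex, until it runs into the
second hexagon (`not_adj_of_blocked`); conversely, an explicit perfect matching `mate` of the
remaining vertices exists once each pair is separated by a kink (`mate_spec`).

If `a` linear hexagons and one kink alternate, the sextet polynomials `g m` therefore satisfy
`g (m + 2) = (1 + a x) g (m + 1) + x g m`, `g 0 = 1`, `g 1 = 1 + a x`. For `x = -s ^ 2` and
`1 - a s ^ 2 = 2 s cos θ` this is the recursion of the Chebyshev polynomials of the second kind, and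
`g m * sin θ = s ^ m * sin ((m + 1) θ)` (`sin_mul_freeSum_zigzag`). So `x` is a zero whenever
`θ ∈ (0, π)` is a multiple of `π / (m + 1)`. Every `x < 0` arises from some `a` and some `θ`, and for
fixed `a` it depends continuously on `θ`; as the rational multiples of `π` are dense, so are the
zeros (`mem_closure_of_neg`).
-/

namespace SextetZeros

/-! ### The sextet polynomial as a sum over the resonant patterns -/

section
variable {V : Type}

lemma finite_resonantPatterns [Finite V] (G : SimpleGraph V) (pos : V → ℂ) :
    (resonantPatterns G pos).Finite := Set.toFinite _

/-- The sextet polynomial is the generating polynomial of the resonant patterns. -/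
lemma eval_sextetPolynomial [Finite V] (G : SimpleGraph V) (pos : V → ℂ) (r : ℝ) :
    (sextetPolynomial G pos).eval r =
      ∑ K ∈ (finite_resonantPatterns G pos).toFinset, r ^ K.ncard := by
  classical
  have hbdd : BddAbove {k | ∃ K ∈ resonantPatterns G pos, K.ncard = k} :=
    (((finite_resonantPatterns G pos).image Set.ncard).subset (by
      rintro k ⟨K, hK, rfl⟩; exact ⟨K, hK, rfl⟩)).bddAbove
  have hmaps : ∀ K ∈ (finite_resonantPatterns G pos).toFinset,
      K.ncard ∈ Finset.range (clarNumber G pos + 1) := by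
    intro K hK
    rw [Set.Finite.mem_toFinset] at hK
    exact Finset.mem_range.2 (Nat.lt_succ_of_le (le_csSup hbdd ⟨K, hK, rfl⟩))
  rw [← Finset.sum_fiberwise_of_maps_to hmaps, sextetPolynomial, Polynomial.eval_finsetSum]
  refine Finset.sum_congr rfl fun k _ => ?_
  have hcard : sextetNumber G pos k =
      ((finite_resonantPatterns G pos).toFinset.filter fun K => K.ncard = k).card := by
    rw [sextetNumber, ← Set.ncard_coe_finset]
    congr 1
    ext K
    simp
  rw [Finset.sum_congr rfl fun K hK => by rw [(Finset.mem_filter.1 hK).2], Finset.sum_const,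
    hcard]
  simp

end

/-! ### Hexagonal chains -/

/-- The sign attached to a side of a chain: `true` is the upper side. -/
def sgn (t : Bool) : ℤ := if t then 1 else -1

/-- The vertical positions along the chain with word `σ`, in units of `√3 / 2`: every step goes up
or down by one unit. The centre of the hexagon `i` is at `height σ (i + 1)`. -/
def height (σ : ℕ → Bool) : ℕ → ℤ
  | 0 => 0
  | m + 1 => height σ m + sgn (σ m)

/-- The horizontal coordinate of the `j`-th column of vertices, in units of `1 / 2`. The hexagon `i`
extends from column `2 * i` to column `2 * i + 3`, and its centre has coordinate `3 * i`. -/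
def column (j : ℕ) : ℤ := 3 * (j / 2 : ℕ) - 2 + (j % 2 : ℕ)

/-- `Step σ a b`: in the ladder with word `σ`, the vertex `b` is a neighbour of `a` in the next
column. A vertex is a pair (side, column); each side is a path, and the `i`-th rung joins
`(σ i, 2 * i)` to `(!σ i, 2 * i + 1)`. -/
def Step (σ : ℕ → Bool) (a b : Bool × ℕ) : Prop :=
  b.2 = a.2 + 1 ∧ (a.1 = b.1 ∨ ∃ i, a.2 = 2 * i ∧ a.1 = σ i)

/-- The vertices of the ladder between the rungs `0` and `n`, inclusive: in the first and in the
last column only the end of the rung is kept. -/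
def InChain (σ : ℕ → Bool) (n : ℕ) (a : Bool × ℕ) : Prop :=
  a.2 ≤ 2 * n + 1 ∧ (a.2 = 0 → a.1 = σ 0) ∧ (a.2 = 2 * n + 1 → a.1 = !σ n)

/-- The vertices of the chain of `n` hexagons with word `σ`. -/
abbrev ChainVertex (σ : ℕ → Bool) (n : ℕ) : Type := {a : Bool × ℕ // InChain σ n a}

/-- The chain of `n` hexagons with word `σ`; the hexagon `i` lies between the rungs `i` and
`i + 1`. -/
def chain (σ : ℕ → Bool) (n : ℕ) : SimpleGraph (ChainVertex σ n) where
  Adj a b := Step σ a b ∨ Step σ b a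
  symm := ⟨fun _ _ h => h.symm⟩
  loopless := ⟨fun a h => by rcases h with h | h <;> exact absurd h.1 (by omega)⟩

/-- The position in the plane of a vertex of the ladder. -/
noncomputable def ladderPos (σ : ℕ → Bool) (a : Bool × ℕ) : ℂ :=
  ⟨column a.2 / 2, √3 / 2 * (height σ ((a.2 + 1) / 2) + sgn a.1 : ℤ)⟩

/-- The drawing of the chain. -/
noncomputable def chainPos (σ : ℕ → Bool) (n : ℕ) (a : ChainVertex σ n) : ℂ := ladderPos σ a

/-- The vertices of the hexagon `i`. -/
def cell (σ : ℕ → Bool) (i : ℕ) : Set (Bool × ℕ) :=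
  {a | a = (σ i, 2 * i) ∨ a.2 = 2 * i + 1 ∨ a.2 = 2 * i + 2 ∨ a = (!σ (i + 1), 2 * i + 3)}

/-- The vertices of the hexagon `i` in counterclockwise order, from the rightmost one. -/
def cellCycle (σ : ℕ → Bool) (i : ℕ) : Fin 6 → Bool × ℕ :=
  ![(!σ (i + 1), 2 * i + 3), (true, 2 * i + 2), (true, 2 * i + 1), (σ i, 2 * i),
    (false, 2 * i + 1), (false, 2 * i + 2)]

lemma sgn_true : sgn true = 1 := rfl
lemma sgn_false : sgn false = -1 := rfl
lemma sgn_not (t : Bool) : sgn (!t) = - sgn t := by cases t <;> rfl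
lemma sgn_eq (t : Bool) : sgn t = 1 ∨ sgn t = -1 := by cases t <;> simp [sgn]
lemma height_succ (σ : ℕ → Bool) (m : ℕ) : height σ (m + 1) = height σ m + sgn (σ m) := rfl

lemma mem_cell {σ : ℕ → Bool} {i j : ℕ} {t : Bool} : (t, j) ∈ cell σ i ↔
    (t = σ i ∧ j = 2 * i) ∨ j = 2 * i + 1 ∨ j = 2 * i + 2 ∨ (t = !σ (i + 1) ∧ j = 2 * i + 3) := by
  simp [cell]

lemma range_cellCycle (σ : ℕ → Bool) (i : ℕ) : Set.range (cellCycle σ i) = cell σ i := by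
  ext ⟨t, j⟩
  simp only [Set.mem_range, mem_cell]
  constructor
  · rintro ⟨k, hk⟩
    obtain ⟨rfl, rfl⟩ := Prod.ext_iff.1 hk
    fin_cases k <;> simp [cellCycle]
  · rintro (⟨rfl, rfl⟩ | rfl | rfl | ⟨rfl, rfl⟩)
    · exact ⟨3, rfl⟩
    · cases t
      · exact ⟨4, rfl⟩
      · exact ⟨2, rfl⟩
    · cases t
      · exact ⟨5, rfl⟩
      · exact ⟨1, rfl⟩
    · exact ⟨0, rfl⟩

lemma cell_subset_inChain {σ : ℕ → Bool} {n i : ℕ} (hi : i < n) {a : Bool × ℕ}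
    (ha : a ∈ cell σ i) : InChain σ n a := by
  obtain ⟨t, j⟩ := a
  rw [mem_cell] at ha
  simp only [InChain]
  rcases ha with ⟨rfl, rfl⟩ | rfl | rfl | ⟨rfl, rfl⟩
  · exact ⟨by omega, fun h => by rw [show i = 0 by omega], fun h => by omega⟩
  · exact ⟨by omega, fun h => by omega, fun h => by omega⟩
  · exact ⟨by omega, fun h => by omega, fun h => by omega⟩
  · exact ⟨by omega, fun h => by omega, fun h => by rw [show n = i + 1 by omega]⟩

lemma step_even {σ : ℕ → Bool} {i : ℕ} {t t' : Bool} :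
    Step σ (t, 2 * i) (t', 2 * i + 1) ↔ t = t' ∨ t = σ i := by
  simp [Step]

lemma step_odd {σ : ℕ → Bool} {i : ℕ} {t t' : Bool} :
    Step σ (t, 2 * i + 1) (t', 2 * i + 2) ↔ t = t' := by
  refine ⟨fun h => h.2.resolve_right ?_, fun h => ⟨rfl, Or.inl h⟩⟩
  rintro ⟨k, hk, -⟩
  simp only at hk
  omega

lemma cellCycle_adj (σ : ℕ → Bool) (i : ℕ) (k : Fin 6) :
    Step σ (cellCycle σ i k) (cellCycle σ i (k + 1)) ∨
      Step σ (cellCycle σ i (k + 1)) (cellCycle σ i k) := by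
  have h : ∀ t u : Bool, t = !u ∨ t = u := by decide
  fin_cases k
  · exact Or.inr ((step_even (i := i + 1)).2 (h _ _))
  · exact Or.inr (step_odd.2 rfl)
  · exact Or.inr (step_even.2 (Or.inr rfl))
  · exact Or.inl (step_even.2 (Or.inr rfl))
  · exact Or.inl (step_odd.2 rfl)
  · exact Or.inl ((step_even (i := i + 1)).2 (h _ _))

/-- The subgraph induced on a hexagon has no further edges. -/
lemma cellCycle_adj_imp {σ : ℕ → Bool} {i : ℕ} {k l : Fin 6}
    (h : Step σ (cellCycle σ i k) (cellCycle σ i l)) : l = k + 1 ∨ k = l + 1 := by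
  have h1 := h.1
  fin_cases k <;> fin_cases l <;> simp [cellCycle] at h1 ⊢ <;>
    first
    | omega
    | exact absurd (step_odd.1 h) (by simp)

/-- The two ends of an edge of the chain lie on a common hexagon. -/
lemma exists_cell_of_step {σ : ℕ → Bool} {n : ℕ} (hn : 1 ≤ n) {a b : Bool × ℕ}
    (ha : InChain σ n a) (hb : InChain σ n b) (h : Step σ a b) :
    ∃ i < n, a ∈ cell σ i ∧ b ∈ cell σ i := by
  obtain ⟨t, j⟩ := a
  obtain ⟨t', j'⟩ := b
  obtain rfl : j' = j + 1 := h.1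
  simp only [mem_cell]
  obtain ⟨i, rfl | rfl⟩ := Nat.even_or_odd' j
  · rw [step_even] at h
    have ha2 := ha.2.1
    have hb1 := hb.1
    have hb2 := hb.2.2
    simp only at ha2 hb1 hb2
    by_cases hi : i < n ∧ t = σ i
    · exact ⟨i, hi.1, Or.inl ⟨hi.2, rfl⟩, Or.inr (Or.inl rfl)⟩
    · obtain ⟨k, rfl⟩ : ∃ k, i = k + 1 := by
        refine Nat.exists_eq_succ_of_ne_zero ?_
        rintro rfl
        exact hi ⟨hn, ha2 rfl⟩
      refine ⟨k, by omega, by omega, ?_⟩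
      right; right; right
      refine ⟨?_, by omega⟩
      by_cases hk : k + 1 < n
      · have : t ≠ σ (k + 1) := fun h' => hi ⟨hk, h'⟩
        rw [← h.resolve_right this]
        cases t <;> cases h : σ (k + 1) <;> simp_all
      · obtain rfl : n = k + 1 := by omega
        exact hb2 rfl
  · rw [step_odd] at h
    exact ⟨i, by have := hb.1; simp only at this; omega, by omega, by omega⟩

/-! ### Connectivity of a chain -/

/-- The first column of the side `t` of a chain. -/
def firstColumn (σ : ℕ → Bool) (t : Bool) : ℕ := if t = σ 0 then 0 else 1

/-- The last column of the side `t` of a chain of `n` hexagons. -/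
def lastColumn (σ : ℕ → Bool) (n : ℕ) (t : Bool) : ℕ := if t = σ n then 2 * n else 2 * n + 1

lemma inChain_iff {σ : ℕ → Bool} {n j : ℕ} {t : Bool} :
    InChain σ n (t, j) ↔ firstColumn σ t ≤ j ∧ j ≤ lastColumn σ n t := by
  simp only [InChain, firstColumn, lastColumn]
  generalize σ 0 = s
  generalize σ n = u
  cases t <;> cases s <;> cases u <;> simp <;> omega

section
variable {σ : ℕ → Bool} {n : ℕ} {v : Bool × ℕ}

lemma reachable_side {t : Bool} {j l : ℕ} (hj : InChain σ n (t, j)) (hl : InChain σ n (t, l))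
    (hjl : j ≤ l) (h : ∀ m, j ≤ m → m ≤ l → (t, m) ≠ v) :
    ((chain σ n).induce {x : ChainVertex σ n | x.1 ≠ v}).Reachable
      ⟨⟨(t, j), hj⟩, h j le_rfl hjl⟩ ⟨⟨(t, l), hl⟩, h l hjl le_rfl⟩ := by
  induction l, hjl using Nat.le_induction with
  | base => exact SimpleGraph.Reachable.refl _
  | succ l hjl ih =>
    have hl' : InChain σ n (t, l) := by
      rw [inChain_iff] at *
      omega
    refine (ih hl' fun m h1 h2 => h m h1 (by omega)).trans (SimpleGraph.Adj.reachable ?_)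
    exact Or.inl ⟨rfl, Or.inl rfl⟩

lemma reachable_first {t : Bool} (h1 : (t, firstColumn σ t) ≠ v)
    (h2 : (!t, firstColumn σ (!t)) ≠ v) (hi1 : InChain σ n (t, firstColumn σ t))
    (hi2 : InChain σ n (!t, firstColumn σ (!t))) :
    ((chain σ n).induce {x : ChainVertex σ n | x.1 ≠ v}).Reachable ⟨⟨(t, firstColumn σ t), hi1⟩, h1⟩
      ⟨⟨(!t, firstColumn σ (!t)), hi2⟩, h2⟩ := by
  refine SimpleGraph.Adj.reachable ?_
  change Step σ _ _ ∨ Step σ _ _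
  simp only [firstColumn]
  by_cases h : t = σ 0
  · left; subst h; simp [Step]
  · right; obtain rfl := Bool.eq_not.2 h; simp [Step]

lemma reachable_last {t : Bool} (h1 : (t, lastColumn σ n t) ≠ v)
    (h2 : (!t, lastColumn σ n (!t)) ≠ v) (hi1 : InChain σ n (t, lastColumn σ n t))
    (hi2 : InChain σ n (!t, lastColumn σ n (!t))) :
    ((chain σ n).induce {x : ChainVertex σ n | x.1 ≠ v}).Reachable ⟨⟨(t, lastColumn σ n t), hi1⟩, h1⟩
      ⟨⟨(!t, lastColumn σ n (!t)), hi2⟩, h2⟩ := by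
  refine SimpleGraph.Adj.reachable ?_
  change Step σ _ _ ∨ Step σ _ _
  simp only [lastColumn]
  by_cases h : t = σ n
  · left; simp [← h, step_even]
  · right; have h' := Bool.eq_not.2 h; simp [h', step_even]

end

lemma firstColumn_le_lastColumn (σ : ℕ → Bool) (n : ℕ) (t : Bool) :
    firstColumn σ t ≤ lastColumn σ n t := by
  simp only [firstColumn, lastColumn]
  by_cases hn : n = 0
  · subst hn
    split_ifs <;> omega
  · split_ifs <;> omega

/-- Deleting a vertex of one side leaves the other side connected, and the two pieces of the
former remain joined to the latter by the first and by the last rung. -/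
lemma preconnected_delete (σ : ℕ → Bool) (n : ℕ) (v : Bool × ℕ) :
    ((chain σ n).induce {x : ChainVertex σ n | x.1 ≠ v}).Preconnected := by
  obtain ⟨s, k⟩ := v
  have hfirst : ∀ t, InChain σ n (t, firstColumn σ t) := fun t =>
    inChain_iff.2 ⟨le_rfl, firstColumn_le_lastColumn σ n t⟩
  have hlast : ∀ t, InChain σ n (t, lastColumn σ n t) := fun t =>
    inChain_iff.2 ⟨firstColumn_le_lastColumn σ n t, le_rfl⟩
  have hne : ∀ m, ((!s, m) : Bool × ℕ) ≠ (s, k) := fun m h => by simp at h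
  suffices h : ∀ w, ((chain σ n).induce {x : ChainVertex σ n | x.1 ≠ (s, k)}).Reachable w
      ⟨⟨(!s, firstColumn σ (!s)), hfirst _⟩, hne _⟩ from fun x y => (h x).trans (h y).symm
  rintro ⟨⟨⟨t, j⟩, hw⟩, hwv⟩
  have hj := inChain_iff.1 hw
  by_cases hts : t = s
  · subst hts
    have hjk : j ≠ k := fun h => hwv (Prod.ext rfl h)
    rcases lt_or_gt_of_ne hjk with hlt | hgt
    · have hm : ∀ m, firstColumn σ t ≤ m → m ≤ j → ((t, m) : Bool × ℕ) ≠ (t, k) :=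
        fun m _ h2 h => by
          simp only [Prod.mk.injEq, true_and] at h
          omega
      exact (reachable_side (hfirst t) hw hj.1 hm).symm.trans
        (reachable_first (hm _ le_rfl hj.1) (hne _) _ _)
    · have hm : ∀ m, j ≤ m → m ≤ lastColumn σ n t → ((t, m) : Bool × ℕ) ≠ (t, k) :=
        fun m h1 _ h => by
          simp only [Prod.mk.injEq, true_and] at h
          omega
      exact (reachable_side hw (hlast t) hj.2 hm).trans
        ((reachable_last (hm _ hj.2 le_rfl) (hne _) _ _).trans
          (reachable_side (hfirst _) (hlast _) (firstColumn_le_lastColumn σ n _)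
            fun _ _ _ => hne _).symm)
  · obtain rfl := Bool.eq_not.2 hts
    exact (reachable_side (hfirst _) hw hj.1 fun _ _ _ => hne _).symm

lemma chain_connected (σ : ℕ → Bool) (n : ℕ) : (chain σ n).Connected := by
  have hv : ∀ x : ChainVertex σ n, x.1 ≠ (true, 2 * n + 2) := fun x h => by
    have := x.2.1
    rw [h] at this
    simp at this
  rw [SimpleGraph.connected_iff]
  refine ⟨fun x y => ?_, ⟨⟨(σ 0, 0), by simp [InChain]⟩⟩⟩
  exact (preconnected_delete σ n (true, 2 * n + 2) ⟨x, hv x⟩ ⟨y, hv y⟩).map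
    (SimpleGraph.Embedding.induce _).toHom

lemma chain_no_cut_vertex (σ : ℕ → Bool) (n : ℕ) (v : ChainVertex σ n) :
    ((chain σ n).induce {v}ᶜ).Preconnected := by
  have h : ({v}ᶜ : Set (ChainVertex σ n)) = {x : ChainVertex σ n | x.1 ≠ v.1} := by
    ext x
    simp [Subtype.ext_iff]
  rw [h]
  exact preconnected_delete σ n v.1

instance (σ : ℕ → Bool) (n : ℕ) : Finite (ChainVertex σ n) := by
  refine Set.Finite.to_subtype (s := {a | InChain σ n a}) ?_
  refine (Set.finite_univ.prod (Set.finite_le_nat (2 * n + 1))).subset ?_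
  rintro ⟨t, j⟩ h
  exact ⟨trivial, h.1⟩

/-! ### Coordinates -/

/-- Horizontal coordinate in units of `1 / 2`. -/
noncomputable def xCoord : ℂ →ₗ[ℝ] ℝ := (2 : ℝ) • Complex.reLm

/-- Vertical coordinate in units of `√3 / 2`. -/
noncomputable def yCoord : ℂ →ₗ[ℝ] ℝ := (2 / √3 : ℝ) • Complex.imLm

lemma xCoord_apply (z : ℂ) : xCoord z = 2 * z.re := rfl
lemma yCoord_apply (z : ℂ) : yCoord z = 2 / √3 * z.im := rfl

lemma ext_coord {z w : ℂ} (hx : xCoord z = xCoord w) (hy : yCoord z = yCoord w) : z = w := by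
  have h3 : (2 / √3 : ℝ) ≠ 0 := by positivity
  apply Complex.ext
  · simpa [xCoord_apply] using hx
  · exact mul_left_cancel₀ h3 hy

lemma mem_segment_coord {p q z : ℂ} {θ : ℝ} (h0 : 0 ≤ θ) (h1 : θ ≤ 1)
    (hx : xCoord z = (1 - θ) * xCoord p + θ * xCoord q)
    (hy : yCoord z = (1 - θ) * yCoord p + θ * yCoord q) : z ∈ segment ℝ p q := by
  refine ⟨1 - θ, θ, by linarith, h0, by ring, ?_⟩
  apply ext_coord <;> simp only [map_add, map_smul, smul_eq_mul, hx, hy]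

lemma exists_of_mem_segment {p q z : ℂ} (h : z ∈ segment ℝ p q) : ∃ θ : ℝ, 0 ≤ θ ∧ θ ≤ 1 ∧
    xCoord z = (1 - θ) * xCoord p + θ * xCoord q ∧
    yCoord z = (1 - θ) * yCoord p + θ * yCoord q := by
  obtain ⟨a, b, ha, hb, hab, rfl⟩ := h
  obtain rfl : a = 1 - b := by linarith
  exact ⟨b, hb, by linarith,
    by simp only [map_add, map_smul, smul_eq_mul],
    by simp only [map_add, map_smul, smul_eq_mul]⟩

lemma exists_of_mem_openSegment {p q z : ℂ} (h : z ∈ openSegment ℝ p q) : ∃ θ : ℝ, 0 < θ ∧ θ < 1 ∧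
    xCoord z = (1 - θ) * xCoord p + θ * xCoord q ∧
    yCoord z = (1 - θ) * yCoord p + θ * yCoord q := by
  obtain ⟨a, b, ha, hb, hab, rfl⟩ := h
  obtain rfl : a = 1 - b := by linarith
  exact ⟨b, hb, by linarith,
    by simp only [map_add, map_smul, smul_eq_mul],
    by simp only [map_add, map_smul, smul_eq_mul]⟩

lemma xCoord_ladderPos (σ : ℕ → Bool) (a : Bool × ℕ) : xCoord (ladderPos σ a) = column a.2 := by
  simp [xCoord_apply, ladderPos]
  ring

lemma yCoord_ladderPos (σ : ℕ → Bool) (a : Bool × ℕ) :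
    yCoord (ladderPos σ a) = (height σ ((a.2 + 1) / 2) + sgn a.1 : ℤ) := by
  have h3 : (√3 : ℝ) ≠ 0 := by positivity
  simp only [yCoord_apply, ladderPos]
  field_simp

lemma column_even (i : ℕ) : column (2 * i) = 3 * i - 2 := by simp [column]
lemma column_odd (i : ℕ) : column (2 * i + 1) = 3 * i - 1 := by
  simp only [column]; omega

lemma column_strictMono : StrictMono column := by
  refine strictMono_nat_of_lt_succ fun j => ?_
  simp only [column]; omega

lemma yCoord_even (σ : ℕ → Bool) (t : Bool) (i : ℕ) :
    yCoord (ladderPos σ (t, 2 * i)) = height σ i + sgn t := by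
  rw [yCoord_ladderPos, show ((t, 2 * i).2 + 1) / 2 = i by simp only; omega]
  push_cast; rfl

lemma yCoord_odd (σ : ℕ → Bool) (t : Bool) (i : ℕ) :
    yCoord (ladderPos σ (t, 2 * i + 1)) = height σ (i + 1) + sgn t := by
  rw [yCoord_ladderPos, show ((t, 2 * i + 1).2 + 1) / 2 = i + 1 by simp only; omega]
  push_cast; rfl

/-! ### The drawing of a chain is plane -/

lemma sgn_injective : Function.Injective sgn := by decide

lemma ladderPos_injective (σ : ℕ → Bool) : Function.Injective (ladderPos σ) := by
  rintro ⟨t, j⟩ ⟨t', j'⟩ h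
  have hx := congrArg xCoord h
  rw [xCoord_ladderPos, xCoord_ladderPos] at hx
  obtain rfl : j = j' := column_strictMono.injective (by exact_mod_cast hx)
  have hy := congrArg yCoord h
  rw [yCoord_ladderPos, yCoord_ladderPos] at hy
  have hy' : sgn t = sgn t' := by
    have := Int.cast_injective hy
    simpa using this
  rw [sgn_injective hy']

lemma column_lt_of_mem_openSegment {σ : ℕ → Bool} {a b : Bool × ℕ} {z : ℂ} (h : Step σ a b)
    (hz : z ∈ openSegment ℝ (ladderPos σ a) (ladderPos σ b)) :
    (column a.2 : ℝ) < xCoord z ∧ xCoord z < column (a.2 + 1) := by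
  obtain ⟨θ, h0, h1, hx, -⟩ := exists_of_mem_openSegment hz
  rw [xCoord_ladderPos, xCoord_ladderPos, h.1] at hx
  have : (column a.2 : ℝ) < column (a.2 + 1) := by
    exact_mod_cast column_strictMono (Nat.lt_succ_self _)
  constructor <;> nlinarith

lemma eq_of_column_lt {j k : ℕ} {x : ℝ} (h1 : (column j : ℝ) < x) (h2 : x < column (j + 1))
    (h3 : (column k : ℝ) < x) (h4 : x < column (k + 1)) : j = k := by
  have e1 : column j < column (k + 1) := by exact_mod_cast h1.trans h4
  have e2 : column k < column (j + 1) := by exact_mod_cast h3.trans h2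
  rw [column_strictMono.lt_iff_lt] at e1 e2
  omega

lemma step_eq_of_mem_openSegment {σ : ℕ → Bool} {a b a' b' : Bool × ℕ} {z : ℂ}
    (h : Step σ a b) (h' : Step σ a' b')
    (hz : z ∈ openSegment ℝ (ladderPos σ a) (ladderPos σ b))
    (hz' : z ∈ openSegment ℝ (ladderPos σ a') (ladderPos σ b')) : a = a' ∧ b = b' := by
  have hc := column_lt_of_mem_openSegment h hz
  have hc' := column_lt_of_mem_openSegment h' hz'
  obtain ⟨t, j⟩ := a
  obtain ⟨t', j'⟩ := a'
  obtain ⟨s, l⟩ := b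
  obtain ⟨s', l'⟩ := b'
  obtain rfl : j = j' := eq_of_column_lt hc.1 hc.2 hc'.1 hc'.2
  obtain rfl : l = j + 1 := h.1
  obtain rfl : l' = j + 1 := h'.1
  obtain ⟨θ, h0, h1, hx, hy⟩ := exists_of_mem_openSegment hz
  obtain ⟨θ', h0', h1', hx', hy'⟩ := exists_of_mem_openSegment hz'
  simp only [xCoord_ladderPos] at hx hx'
  have hlt : (column j : ℝ) < column (j + 1) := by
    exact_mod_cast column_strictMono (Nat.lt_succ_self _)
  obtain rfl : θ = θ' := by
    have : (θ - θ') * ((column (j + 1) : ℝ) - column j) = 0 := by linarith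
    rcases mul_eq_zero.1 this with h | h <;> linarith
  simp only [Prod.mk.injEq, and_true]
  rw [hy] at hy'
  obtain ⟨i, rfl | rfl⟩ := Nat.even_or_odd' j
  · rw [step_even] at h h'
    simp only [yCoord_even, yCoord_odd] at hy'
    generalize σ i = r at h h'
    cases t <;> cases t' <;> cases s <;> cases s' <;> cases r <;>
      simp at h h' ⊢ <;> norm_num [sgn] at hy' <;> linarith
  · rw [step_odd] at h h'
    subst h h'
    simp only [show 2 * i + 1 + 1 = 2 * (i + 1) by ring, yCoord_even, yCoord_odd] at hy'
    refine (and_self_iff).2 (sgn_injective ?_)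
    exact_mod_cast (by linarith : (sgn t : ℝ) = sgn t')

lemma chain_isPlane (σ : ℕ → Bool) (n : ℕ) : IsPlane (chain σ n) (chainPos σ n) where
  injective := (ladderPos_injective σ).comp Subtype.val_injective
  vertex_notMem u v w huv hw := by
    wlog h : Step σ u.1 v.1 generalizing u v
    · exact this v u huv.symm (by rwa [openSegment_symm]) (huv.resolve_left h)
    have hc := column_lt_of_mem_openSegment h hw
    rw [chainPos, xCoord_ladderPos] at hc
    have h1 : column u.1.2 < column w.1.2 := by exact_mod_cast hc.1
    have h2 : column w.1.2 < column (u.1.2 + 1) := by exact_mod_cast hc.2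
    rw [column_strictMono.lt_iff_lt] at h1 h2
    omega
  disjoint u v u' v' h h' hne := by
    wlog hs : Step σ u.1 v.1 generalizing u v
    · rw [openSegment_symm]
      exact this v u h.symm (by rwa [Sym2.eq_swap]) (h.resolve_left hs)
    wlog hs' : Step σ u'.1 v'.1 generalizing u' v'
    · rw [openSegment_symm ℝ (chainPos σ n u')]
      exact this v' u' h'.symm (by rwa [Sym2.eq_swap (a := v')]) (h'.resolve_left hs')
    rw [Set.disjoint_left]
    intro z hz hz'
    obtain ⟨e1, e2⟩ := step_eq_of_mem_openSegment hs hs' hz hz'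
    exact hne (by rw [Subtype.ext e1, Subtype.ext e2])

/-! ### The hexagons of a chain -/

/-- The primitive sixth root of unity `exp (iπ / 3)`. -/
noncomputable def ζ : ℂ := ⟨1 / 2, √3 / 2⟩

lemma exp_eq_ζ : Complex.exp (Real.pi / 3 * Complex.I) = ζ := by
  rw [show (Real.pi / 3 * Complex.I : ℂ) = ((Real.pi / 3 : ℝ) : ℂ) * Complex.I by push_cast; rfl]
  apply Complex.ext
  · rw [Complex.exp_ofReal_mul_I_re, Real.cos_pi_div_three]; rfl
  · rw [Complex.exp_ofReal_mul_I_im, Real.sin_pi_div_three]; rfl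

lemma hexVertex_eq (c u : ℂ) (k : Fin 6) : hexVertex c u k = c + u * ζ ^ (k : ℕ) := by
  rw [hexVertex, Complex.exp_nat_mul, exp_eq_ζ]

lemma ζ_sq : ζ ^ 2 = ζ - 1 := by
  have h3 : √3 * √3 = 3 := Real.mul_self_sqrt (by norm_num)
  apply Complex.ext <;> simp [ζ, pow_two] <;> nlinarith

lemma ζ_pow_three : ζ ^ 3 = -1 := by
  linear_combination (ζ + 1) * ζ_sq

lemma ζ_pow_six : ζ ^ 6 = 1 := by
  linear_combination (ζ ^ 3 - 1) * ζ_pow_three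

lemma xCoord_ζ : xCoord ζ = 1 := by simp [xCoord_apply, ζ]
lemma yCoord_ζ : yCoord ζ = 1 := by
  have h3 : (√3 : ℝ) ≠ 0 := by positivity
  simp only [yCoord_apply, ζ]; field_simp
lemma xCoord_one : xCoord 1 = 2 := by simp [xCoord_apply]
lemma yCoord_one : yCoord 1 = 0 := by simp [yCoord_apply]

lemma ζ_pow_values (k : Fin 6) : xCoord (ζ ^ (k : ℕ)) = ![2, 1, -1, -2, -1, 1] k ∧
    yCoord (ζ ^ (k : ℕ)) = ![0, 1, 1, 0, -1, -1] k := by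
  have h4 : ζ ^ 4 = -ζ := by linear_combination ζ * ζ_pow_three
  have h5 : ζ ^ 5 = 1 - ζ := by linear_combination ζ ^ 2 * ζ_pow_three - ζ_sq
  fin_cases k <;>
    simp [xCoord_one, yCoord_one, xCoord_ζ, yCoord_ζ, ζ_sq, ζ_pow_three, h4, h5] <;> norm_num

lemma xCoord_hexVertex (c : ℂ) (k : Fin 6) :
    xCoord (hexVertex c 1 k) = xCoord c + ![2, 1, -1, -2, -1, 1] k := by
  rw [hexVertex_eq, one_mul, map_add, (ζ_pow_values k).1]

lemma yCoord_hexVertex (c : ℂ) (k : Fin 6) :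
    yCoord (hexVertex c 1 k) = yCoord c + ![0, 1, 1, 0, -1, -1] k := by
  rw [hexVertex_eq, one_mul, map_add, (ζ_pow_values k).2]

lemma hexVertex_injective {c u : ℂ} (hu : ‖u‖ = 1) : Function.Injective (hexVertex c u) := by
  have hu0 : u ≠ 0 := by
    rintro rfl
    simp at hu
  intro k l h
  rw [hexVertex_eq, hexVertex_eq, add_right_inj] at h
  have h2 := mul_left_cancel₀ hu0 h
  have hx := congrArg xCoord h2
  have hy := congrArg yCoord h2
  rw [(ζ_pow_values k).1, (ζ_pow_values l).1] at hx
  rw [(ζ_pow_values k).2, (ζ_pow_values l).2] at hy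
  fin_cases k <;> fin_cases l <;>
    first
    | rfl
    | (refine absurd hx ?_; norm_num; done)
    | (refine absurd hy ?_; norm_num)

lemma IsHexagon.injective {V : Type} {G : SimpleGraph V} {pos : V → ℂ} {h : Fin 6 → V}
    (hh : IsHexagon G pos h) : Function.Injective h := by
  obtain ⟨⟨c, u, hu, hpos⟩, -⟩ := hh
  intro k l hkl
  exact hexVertex_injective hu (by rw [← hpos, ← hpos, hkl])

/-- The centre of the hexagon `i`. -/
noncomputable def center (σ : ℕ → Bool) (i : ℕ) : ℂ := ⟨3 * i / 2, √3 / 2 * height σ (i + 1)⟩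

lemma xCoord_center (σ : ℕ → Bool) (i : ℕ) : xCoord (center σ i) = 3 * i := by
  simp only [xCoord_apply, center]; ring

lemma yCoord_center (σ : ℕ → Bool) (i : ℕ) : yCoord (center σ i) = height σ (i + 1) := by
  have h3 : (√3 : ℝ) ≠ 0 := by positivity
  simp only [yCoord_apply, center]; field_simp

lemma ladderPos_cellCycle (σ : ℕ → Bool) (i : ℕ) (k : Fin 6) :
    ladderPos σ (cellCycle σ i k) = hexVertex (center σ i) 1 k := by
  have e1 : 2 * i + 2 = 2 * (i + 1) := by ring
  have e2 : 2 * i + 3 = 2 * (i + 1) + 1 := by ring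
  apply ext_coord
  · rw [xCoord_hexVertex, xCoord_ladderPos, xCoord_center]
    fin_cases k <;> simp [cellCycle, e1, e2, column_even, column_odd] <;> ring
  · rw [yCoord_hexVertex, yCoord_center]
    fin_cases k <;>
      simp [cellCycle, e1, e2, yCoord_even, yCoord_odd, height_succ, sgn_true, sgn_false, sgn_not]

/-- The hexagon `i` as a cycle of the chain. -/
def chainCycle (σ : ℕ → Bool) (n i : ℕ) (hi : i < n) (k : Fin 6) : ChainVertex σ n :=
  ⟨cellCycle σ i k, cell_subset_inChain hi (range_cellCycle σ i ▸ Set.mem_range_self k)⟩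

/-- The vertex set of the hexagon `i` in the chain. -/
def chainCell (σ : ℕ → Bool) (n i : ℕ) : Set (ChainVertex σ n) := {v | v.1 ∈ cell σ i}

lemma range_chainCycle (σ : ℕ → Bool) (n i : ℕ) (hi : i < n) :
    Set.range (chainCycle σ n i hi) = chainCell σ n i := by
  ext v
  rw [chainCell, Set.mem_ofPred_eq, ← range_cellCycle]
  exact exists_congr fun k => Subtype.ext_iff

lemma chainCycle_isHexagon (σ : ℕ → Bool) (n i : ℕ) (hi : i < n) :
    IsHexagon (chain σ n) (chainPos σ n) (chainCycle σ n i hi) :=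
  ⟨⟨center σ i, 1, by simp, ladderPos_cellCycle σ i⟩, cellCycle_adj σ i⟩

/-- The edges of a chain are unit vectors of the triangular lattice. -/
lemma exists_pow_of_step {σ : ℕ → Bool} {a b : Bool × ℕ} (h : Step σ a b) :
    ∃ m : Fin 6, ladderPos σ b - ladderPos σ a = ζ ^ (m : ℕ) := by
  have key : ∀ m : Fin 6, xCoord (ladderPos σ b) - xCoord (ladderPos σ a) =
      ![2, 1, -1, -2, -1, 1] m → yCoord (ladderPos σ b) - yCoord (ladderPos σ a) =
      ![0, 1, 1, 0, -1, -1] m → ∃ m : Fin 6, ladderPos σ b - ladderPos σ a = ζ ^ (m : ℕ) :=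
    fun m h1 h2 => ⟨m, ext_coord (by rw [map_sub, h1, (ζ_pow_values m).1])
      (by rw [map_sub, h2, (ζ_pow_values m).2])⟩
  obtain ⟨t, j⟩ := a
  obtain ⟨s, l⟩ := b
  obtain rfl : l = j + 1 := h.1
  obtain ⟨i, rfl | rfl⟩ := Nat.even_or_odd' j
  · rw [step_even] at h
    simp only [xCoord_ladderPos, yCoord_even, yCoord_odd, column_even, column_odd,
      height_succ] at key
    generalize σ i = r at h key
    have h1 := key 1
    have h2 := key 5
    cases t <;> cases s <;> cases r <;> simp at h <;>
      first
      | (refine h1 ?_ ?_ <;> push_cast [sgn] <;> norm_num; done)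
      | (refine h2 ?_ ?_ <;> push_cast [sgn] <;> norm_num)
  · rw [step_odd] at h
    subst h
    refine key 0 ?_ ?_
    · rw [xCoord_ladderPos, xCoord_ladderPos]
      change (column (2 * (i + 1)) : ℝ) - column (2 * i + 1) = 2
      rw [column_odd, column_even]
      push_cast; ring
    · rw [show (t, 2 * i + 1 + 1) = (t, 2 * (i + 1)) from rfl, yCoord_even, yCoord_odd]; simp

lemma exists_pow_of_adj {σ : ℕ → Bool} {a b : Bool × ℕ} (h : Step σ a b ∨ Step σ b a) :
    ∃ m : ℕ, ladderPos σ b - ladderPos σ a = ζ ^ m := by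
  rcases h with h | h
  · obtain ⟨m, hm⟩ := exists_pow_of_step h
    exact ⟨m, hm⟩
  · obtain ⟨m, hm⟩ := exists_pow_of_step h
    exact ⟨m + 3, by rw [pow_add, ← hm, ζ_pow_three]; ring⟩

/-- A hexagon of the chain has a side in the direction of a sixth root of unity, so after a
rotation of its vertices it starts on the right of its centre. -/
lemma exists_rotation {σ : ℕ → Bool} {n : ℕ} {h : Fin 6 → ChainVertex σ n}
    (hh : IsHexagon (chain σ n) (chainPos σ n) h) :
    ∃ (d : Fin 6) (c : ℂ), ∀ k, ladderPos σ (h (k + d)) = hexVertex c 1 k := by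
  obtain ⟨⟨c, u, -, hpos⟩, hadj⟩ := hh
  obtain ⟨m, hm⟩ := exists_pow_of_adj (hadj 0)
  have hp : ∀ k, ladderPos σ (h k) = c + u * ζ ^ (k : ℕ) := fun k => by
    rw [← hexVertex_eq, ← hpos]; rfl
  have hu : u = ζ ^ (m + 4) := by
    have e : u * ζ ^ 2 = ζ ^ m := by
      rw [← hm, hp, hp, ζ_sq]
      simp
      ring
    rw [pow_add, ← e]
    linear_combination -u * ζ_pow_six
  refine ⟨⟨(5 * (m + 4)) % 6, Nat.mod_lt _ (by norm_num)⟩, c, fun k => ?_⟩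
  rw [hp, hexVertex_eq, hu, one_mul, ← pow_add, pow_eq_pow_mod _ ζ_pow_six,
    Fin.val_add]
  congr 2
  have := k.2
  simp only
  omega

/-- The hexagons of a chain in the sense of the drawing are its cells. -/
lemma IsHexagon.exists_range_eq {σ : ℕ → Bool} {n : ℕ} {h : Fin 6 → ChainVertex σ n}
    (hh : IsHexagon (chain σ n) (chainPos σ n) h) :
    ∃ i < n, Set.range h = chainCell σ n i := by
  obtain ⟨d, c, hp⟩ := exists_rotation hh
  have hx : ∀ k, (column (h (k + d)).1.2 : ℝ) = xCoord c + ![2, 1, -1, -2, -1, 1] k := fun k => by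
    rw [← xCoord_hexVertex, ← hp, xCoord_ladderPos]
  have hadj : Step σ (h (2 + d)).1 (h (1 + d)).1 := by
    have := hh.2 (1 + d)
    rw [show 1 + d + 1 = 2 + d by rw [add_right_comm]; rfl] at this
    refine Or.resolve_left this fun hs => ?_
    have h1 : column (h (1 + d)).1.2 < column (h (2 + d)).1.2 :=
      column_strictMono (by rw [hs.1]; exact Nat.lt_succ_self _)
    have h2 : (column (h (1 + d)).1.2 : ℝ) < column (h (2 + d)).1.2 := by exact_mod_cast h1
    rw [hx, hx] at h2
    simp only [Matrix.cons_val] at h2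
    linarith
  have hcol : (h (4 + d)).1.2 = (h (2 + d)).1.2 := by
    apply column_strictMono.injective
    have : (column (h (4 + d)).1.2 : ℝ) = column (h (2 + d)).1.2 := by
      rw [hx, hx]; simp
    exact_mod_cast this
  have hin1 := (h (1 + d)).2
  obtain ⟨t, j, e2⟩ : ∃ t j, (h (2 + d)).1 = (t, j) := ⟨_, _, rfl⟩
  obtain ⟨s, l, e1⟩ : ∃ t j, (h (1 + d)).1 = (t, j) := ⟨_, _, rfl⟩
  obtain ⟨t', j', e4⟩ : ∃ t j, (h (4 + d)).1 = (t, j) := ⟨_, _, rfl⟩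
  have p2 := hp 2
  have p4 := hp 4
  rw [e1, e2] at hadj
  rw [e2, e4] at hcol
  obtain rfl : j' = j := hcol
  rw [e2] at p2
  rw [e4] at p4
  have x2 := hx 2
  have x1 := hx 1
  rw [e2] at x2
  rw [e1] at x1
  rw [e1] at hin1
  obtain rfl : l = j' + 1 := hadj.1
  obtain ⟨i, rfl | rfl⟩ := Nat.even_or_odd' j'
  · simp only [column_even, column_odd] at x1 x2
    push_cast at x1 x2
    linarith
  · have y2 := congrArg yCoord p2
    have y4 := congrArg yCoord p4
    rw [yCoord_hexVertex, yCoord_odd] at y2 y4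
    have ht : t = true := by
      have : (sgn t : ℝ) - sgn t' = 2 := by simp only [Matrix.cons_val] at y2 y4; linarith
      revert this
      cases t <;> cases t' <;> norm_num [sgn]
    subst ht
    have hc : c = center σ i := by
      apply ext_coord
      · rw [xCoord_center]
        simp only [column_odd] at x2
        push_cast at x2
        linarith
      · rw [yCoord_center]
        simp [sgn] at y2
        linarith
    refine ⟨i, by have := hin1.1; simp only at this; omega, ?_⟩
    have hk : ∀ k, (h (k + d)).1 = cellCycle σ i k := fun k => by
      apply ladderPos_injective σ
      rw [ladderPos_cellCycle, hp, hc]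
    ext v
    rw [chainCell, Set.mem_ofPred_eq, ← range_cellCycle]
    constructor
    · rintro ⟨k, rfl⟩
      exact ⟨k - d, by rw [← hk, sub_add_cancel]⟩
    · rintro ⟨k, hv⟩
      exact ⟨k + d, Subtype.ext (by rw [hk, hv])⟩

/-! ### The faces of a chain -/

/-- The norm of the plane whose unit ball is the regular hexagon with vertices the sixth roots of
unity. -/
noncomputable def hexNorm : Seminorm ℝ ℂ :=
  (normSeminorm ℝ ℝ).comp yCoord ⊔
    ((normSeminorm ℝ ℝ).comp ((1 / 2 : ℝ) • (xCoord + yCoord)) ⊔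
      (normSeminorm ℝ ℝ).comp ((1 / 2 : ℝ) • (xCoord - yCoord)))

lemma hexNorm_apply (z : ℂ) : hexNorm z =
    max |yCoord z| (max |(xCoord z + yCoord z) / 2| |(xCoord z - yCoord z) / 2|) := by
  simp only [hexNorm, Seminorm.sup_apply, Seminorm.comp_apply, coe_normSeminorm,
    Real.norm_eq_abs, LinearMap.smul_apply, LinearMap.add_apply, LinearMap.sub_apply, smul_eq_mul]
  congr 3 <;> ring

lemma continuous_xCoord : Continuous xCoord := xCoord.continuous_of_finiteDimensional
lemma continuous_yCoord : Continuous yCoord := yCoord.continuous_of_finiteDimensional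

lemma continuous_hexNorm : Continuous hexNorm := by
  have h1 := continuous_xCoord
  have h2 := continuous_yCoord
  have : (fun z => hexNorm z) = _ := funext hexNorm_apply
  change Continuous (fun z => hexNorm z)
  rw [this]
  fun_prop

lemma hexNorm_le_iff {z : ℂ} {r : ℝ} : hexNorm z ≤ r ↔
    (-r ≤ yCoord z ∧ yCoord z ≤ r) ∧
    (-(2 * r) ≤ xCoord z + yCoord z ∧ xCoord z + yCoord z ≤ 2 * r) ∧
    (-(2 * r) ≤ xCoord z - yCoord z ∧ xCoord z - yCoord z ≤ 2 * r) := by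
  rw [hexNorm_apply, max_le_iff, max_le_iff, abs_le, abs_le, abs_le]
  refine and_congr Iff.rfl (and_congr ?_ ?_) <;>
    constructor <;> rintro ⟨h1, h2⟩ <;> constructor <;> linarith

lemma hexNorm_lt_iff {z : ℂ} {r : ℝ} : hexNorm z < r ↔
    (-r < yCoord z ∧ yCoord z < r) ∧
    (-(2 * r) < xCoord z + yCoord z ∧ xCoord z + yCoord z < 2 * r) ∧
    (-(2 * r) < xCoord z - yCoord z ∧ xCoord z - yCoord z < 2 * r) := by
  rw [hexNorm_apply, max_lt_iff, max_lt_iff, abs_lt, abs_lt, abs_lt]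
  refine and_congr Iff.rfl (and_congr ?_ ?_) <;>
    constructor <;> rintro ⟨h1, h2⟩ <;> constructor <;> linarith

/-- A point of a side of the hexagon has distance `1` from its centre. -/
lemma hexNorm_of_mem_segment {c z : ℂ} {k : Fin 6}
    (h : z ∈ segment ℝ (hexVertex c 1 k) (hexVertex c 1 (k + 1))) : hexNorm (z - c) = 1 := by
  obtain ⟨θ, h0, h1, hx, hy⟩ := exists_of_mem_segment h
  rw [xCoord_hexVertex, xCoord_hexVertex] at hx
  rw [yCoord_hexVertex, yCoord_hexVertex] at hy
  refine le_antisymm (hexNorm_le_iff.2 ?_) (not_lt.1 fun hlt => ?_)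
  · rw [map_sub, map_sub, hx, hy]
    fin_cases k <;> simp <;> refine ⟨⟨?_, ?_⟩, ⟨?_, ?_⟩, ?_, ?_⟩ <;> linarith
  · rw [hexNorm_lt_iff, map_sub, map_sub, hx, hy] at hlt
    obtain ⟨⟨a1, a2⟩, ⟨a3, a4⟩, a5, a6⟩ := hlt
    fin_cases k <;> simp at a1 a2 a3 a4 a5 a6 <;> linarith

/-- A point at distance `1` from the centre lies on a side of the hexagon. -/
lemma exists_mem_segment_of_hexNorm {c z : ℂ} (h : hexNorm (z - c) = 1) :
    ∃ k : Fin 6, z ∈ segment ℝ (hexVertex c 1 k) (hexVertex c 1 (k + 1)) := by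
  have hle := hexNorm_le_iff.1 h.le
  have hnlt := mt hexNorm_lt_iff.2 h.not_lt
  rw [map_sub, map_sub] at hle hnlt
  obtain ⟨⟨a1, a2⟩, ⟨a3, a4⟩, a5, a6⟩ := hle
  have key : ∀ (k : Fin 6) (θ : ℝ), 0 ≤ θ → θ ≤ 1 →
      xCoord z - xCoord c = (1 - θ) * (![2, 1, -1, -2, -1, 1] : Fin 6 → ℝ) k +
        θ * (![2, 1, -1, -2, -1, 1] : Fin 6 → ℝ) (k + 1) →
      yCoord z - yCoord c = (1 - θ) * (![0, 1, 1, 0, -1, -1] : Fin 6 → ℝ) k +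
        θ * (![0, 1, 1, 0, -1, -1] : Fin 6 → ℝ) (k + 1) →
      ∃ k : Fin 6, z ∈ segment ℝ (hexVertex c 1 k) (hexVertex c 1 (k + 1)) := by
    intro k θ h0 h1 hx hy
    refine ⟨k, mem_segment_coord h0 h1 ?_ ?_⟩
    · rw [xCoord_hexVertex, xCoord_hexVertex]; linarith
    · rw [yCoord_hexVertex, yCoord_hexVertex]; linarith
  generalize xCoord z - xCoord c = x at *
  generalize yCoord z - yCoord c = y at *
  by_cases b1 : y = 1
  · exact key 1 ((1 - x) / 2) (by linarith) (by linarith) (by simp; ring) (by simp [b1])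
  by_cases b2 : y = -1
  · exact key 4 ((x + 1) / 2) (by linarith) (by linarith) (by simp; ring) (by simp [b2]; ring)
  have b1' := lt_of_le_of_ne a2 b1
  have b2' := lt_of_le_of_ne a1 (Ne.symm b2)
  rcases le_total 0 y with hy | hy
  · by_cases b3 : x + y = 2
    · exact key 0 y hy (by linarith) (by simp; linarith) (by simp)
    · have b4 : x - y = -2 := by
        by_contra b4
        have := lt_of_le_of_ne a5 (fun h => b4 (by linarith))
        have := lt_of_le_of_ne a4 (fun h => b3 (by linarith))
        exact hnlt ⟨⟨by linarith, by linarith⟩, ⟨by linarith, by linarith⟩, by linarith,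
          by linarith⟩
      exact key 2 (1 - y) (by linarith) (by linarith) (by simp; linarith) (by simp)
  · by_cases b3 : x + y = -2
    · exact key 3 (-y) (by linarith) (by linarith) (by simp; linarith) (by simp)
    · have b4 : x - y = 2 := by
        by_contra b4
        have := lt_of_le_of_ne a6 (fun h => b4 (by linarith))
        have := lt_of_le_of_ne a3 (fun h => b3 (by linarith))
        exact hnlt ⟨⟨by linarith, by linarith⟩, ⟨by linarith, by linarith⟩, by linarith,
          by linarith⟩
      exact key 5 (1 + y) (by linarith) (by linarith) (by simp; linarith) (by simp)

lemma mem_convexHull_of_hexNorm_eq {c z : ℂ} (h : hexNorm (z - c) = 1) :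
    z ∈ convexHull ℝ (Set.range (hexVertex c 1)) := by
  obtain ⟨k, hk⟩ := exists_mem_segment_of_hexNorm h
  exact (convex_convexHull ℝ _).segment_subset (subset_convexHull ℝ _ (Set.mem_range_self k))
    (subset_convexHull ℝ _ (Set.mem_range_self (k + 1))) hk

lemma mem_closedBall_iff {c z : ℂ} {r : ℝ} :
    z ∈ hexNorm.closedBall c r ↔ hexNorm (z - c) ≤ r := Seminorm.mem_closedBall _

lemma convexHull_hexVertex (c : ℂ) :
    convexHull ℝ (Set.range (hexVertex c 1)) = hexNorm.closedBall c 1 := by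
  refine Set.Subset.antisymm (convexHull_min ?_ (hexNorm.convex_closedBall c 1)) fun z hz => ?_
  · rintro _ ⟨k, rfl⟩
    exact mem_closedBall_iff.2 (hexNorm_of_mem_segment (left_mem_segment ℝ _ _)).le
  · have hz' := mem_closedBall_iff.1 hz
    by_cases h1 : hexNorm (z - c) = 1
    · exact mem_convexHull_of_hexNorm_eq h1
    -- The horizontal line through `z` leaves the hexagon at two boundary points.
    have hlt := hexNorm_lt_iff.1 (lt_of_le_of_ne hz' h1)
    obtain ⟨⟨a1, a2⟩, ⟨a3, a4⟩, a5, a6⟩ := hlt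
    rw [map_sub] at a1 a2
    rw [map_sub, map_sub] at a3 a4 a5 a6
    set x := xCoord z - xCoord c with hx
    set y := yCoord z - yCoord c with hy
    have hy1 : |y| < 1 := abs_lt.2 ⟨by linarith, by linarith⟩
    have hxy : x < 2 - |y| ∧ -(2 - |y|) < x := by
      rcases abs_cases y with ⟨e, -⟩ | ⟨e, -⟩ <;> rw [e] <;> constructor <;> linarith
    have hb : ∀ w : ℝ, w = 2 - |y| ∨ w = -(2 - |y|) →
        z + ((w - x) / 2 : ℝ) ∈ convexHull ℝ (Set.range (hexVertex c 1)) := by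
      intro w hw
      apply mem_convexHull_of_hexNorm_eq
      have ex : xCoord (z + ((w - x) / 2 : ℝ) - c) = w := by
        rw [map_sub, map_add, xCoord_apply (((w - x) / 2 : ℝ) : ℂ), Complex.ofReal_re]
        linarith
      have ey : yCoord (z + ((w - x) / 2 : ℝ) - c) = y := by
        rw [map_sub, map_add, yCoord_apply (((w - x) / 2 : ℝ) : ℂ), Complex.ofReal_im]
        linarith
      refine le_antisymm (hexNorm_le_iff.2 ?_) (not_lt.1 fun hlt => ?_)
      · rw [ex, ey]
        rcases abs_cases y with ⟨e, e'⟩ | ⟨e, e'⟩ <;> rw [e] at hw hy1 <;>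
          rcases hw with rfl | rfl <;> refine ⟨⟨?_, ?_⟩, ⟨?_, ?_⟩, ?_, ?_⟩ <;> linarith
      · rw [hexNorm_lt_iff, ex, ey] at hlt
        obtain ⟨-, ⟨a3, a4⟩, a5, a6⟩ := hlt
        rcases abs_cases y with ⟨e, -⟩ | ⟨e, -⟩ <;> rw [e] at hw <;>
          rcases hw with rfl | rfl <;> linarith
    refine (convex_convexHull ℝ _).segment_subset (hb _ (Or.inr rfl)) (hb _ (Or.inl rfl)) ?_
    have hpos : 0 < 2 - |y| := by linarith
    refine mem_segment_coord (θ := (x + (2 - |y|)) / (2 * (2 - |y|)))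
      (div_nonneg (by linarith) (by linarith)) ((div_le_one (by linarith)).2 (by linarith)) ?_ ?_
    · simp only [map_add, xCoord_apply, Complex.ofReal_re]
      field_simp
      ring
    · simp only [map_add, yCoord_apply, Complex.ofReal_im]
      ring

lemma interior_hexagon (c : ℂ) :
    interior (convexHull ℝ (Set.range (hexVertex c 1))) = {z | hexNorm (z - c) < 1} := by
  rw [convexHull_hexVertex]
  refine Set.Subset.antisymm (fun z hz => ?_) (interior_maximal ?_ ?_)
  · have hcont : Continuous fun t : ℝ => c + t • (z - c) := by fun_prop
    have h1 : ∀ᶠ t in nhds (1 : ℝ), c + t • (z - c) ∈ hexNorm.closedBall c 1 :=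
      hcont.continuousAt.preimage_mem_nhds (by
        rw [one_smul, add_sub_cancel]
        exact mem_interior_iff_mem_nhds.1 hz)
    obtain ⟨t, ht, ht1⟩ := ((h1.filter_mono nhdsWithin_le_nhds).and
      (self_mem_nhdsWithin (s := Set.Ioi (1 : ℝ)))).exists
    change 1 < t at ht1
    rw [mem_closedBall_iff, add_sub_cancel_left, map_smul_eq_mul, Real.norm_eq_abs,
      abs_of_pos (by linarith)] at ht
    have h0 := apply_nonneg hexNorm (z - c)
    change hexNorm (z - c) < 1
    by_contra! hge
    nlinarith
  · exact fun z hz => mem_closedBall_iff.2 (le_of_lt hz)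
  · exact isOpen_lt (continuous_hexNorm.comp (by fun_prop)) continuous_const

section
variable {σ : ℕ → Bool}

lemma height_succ_cast (σ : ℕ → Bool) (m : ℕ) :
    (height σ (m + 1) : ℝ) = height σ m + 1 ∨ (height σ (m + 1) : ℝ) = height σ m - 1 := by
  rw [height_succ]
  rcases sgn_eq (σ m) with h | h <;> rw [h] <;> push_cast
  · exact Or.inl rfl
  · exact Or.inr rfl

/-- The hexagons `i` and `k` have disjoint interiors: they are far apart, or separated by the line
through their common side. -/
lemma eq_of_hexNorm_lt {i k : ℕ} {z : ℂ} (hi : hexNorm (z - center σ i) ≤ 1)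
    (hk : hexNorm (z - center σ k) < 1) : i = k := by
  rw [hexNorm_le_iff, map_sub, map_sub, xCoord_center, yCoord_center] at hi
  rw [hexNorm_lt_iff, map_sub, map_sub, xCoord_center, yCoord_center] at hk
  obtain ⟨⟨a1, a2⟩, ⟨a3, a4⟩, a5, a6⟩ := hi
  obtain ⟨⟨b1, b2⟩, ⟨b3, b4⟩, b5, b6⟩ := hk
  have h1 : (i : ℝ) < k + 2 := by linarith
  have h2 : (k : ℝ) < i + 2 := by linarith
  have h1' : i < k + 2 := by exact_mod_cast h1
  have h2' : k < i + 2 := by exact_mod_cast h2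
  by_contra hne
  rcases (by omega : k = i + 1 ∨ i = k + 1) with rfl | rfl
  · push_cast at *
    rcases height_succ_cast σ (i + 1) with h | h <;> linarith
  · push_cast at *
    rcases height_succ_cast σ (k + 1) with h | h <;> linarith

lemma exists_cell_of_inChain {n : ℕ} (hn : 1 ≤ n) {a : Bool × ℕ} (ha : InChain σ n a) :
    ∃ i < n, a ∈ cell σ i := by
  obtain ⟨t, j⟩ := a
  obtain ⟨h1, h2, h3⟩ := ha
  simp only [mem_cell]
  simp only at h1 h2 h3
  rcases Nat.eq_zero_or_pos j with rfl | hj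
  · exact ⟨0, hn, Or.inl ⟨h2 rfl, rfl⟩⟩
  rcases Nat.eq_or_lt_of_le h1 with rfl | hlt
  · obtain ⟨k, rfl⟩ : ∃ k, n = k + 1 := Nat.exists_eq_succ_of_ne_zero (by omega)
    exact ⟨k, by omega, Or.inr (Or.inr (Or.inr ⟨h3 rfl, by omega⟩))⟩
  · exact ⟨(j - 1) / 2, by omega, by omega⟩

/-- The drawing of a chain is contained in the union of the boundaries of its hexagons. -/
lemma exists_hexNorm_eq_of_mem_drawing {n : ℕ} (hn : 1 ≤ n) {z : ℂ}
    (hz : z ∈ drawing (chain σ n) (chainPos σ n)) :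
    ∃ i < n, hexNorm (z - center σ i) = 1 := by
  rcases hz with ⟨v, rfl⟩ | ⟨u, v, huv, hz⟩
  · obtain ⟨i, hi, hv⟩ := exists_cell_of_inChain hn v.2
    rw [← range_cellCycle] at hv
    obtain ⟨k, hk⟩ := hv
    refine ⟨i, hi, hexNorm_of_mem_segment (k := k) ?_⟩
    rw [chainPos, ← hk, ladderPos_cellCycle]
    exact left_mem_segment ℝ _ _
  · wlog h : Step σ u.1 v.1 generalizing u v
    · exact this v u huv.symm (by rwa [segment_symm]) (huv.resolve_left h)
    obtain ⟨i, hi, hu, hv⟩ := exists_cell_of_step hn u.2 v.2 h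
    rw [← range_cellCycle] at hu hv
    obtain ⟨k, hk⟩ := hu
    obtain ⟨l, hl⟩ := hv
    rw [chainPos, chainPos, ← hk, ← hl, ladderPos_cellCycle, ladderPos_cellCycle] at hz
    rw [← hk, ← hl] at h
    refine ⟨i, hi, ?_⟩
    rcases cellCycle_adj_imp h with rfl | rfl
    · exact hexNorm_of_mem_segment hz
    · exact hexNorm_of_mem_segment (by rwa [segment_symm])

lemma mem_drawing_of_hexNorm_eq {n i : ℕ} (hi : i < n) {z : ℂ}
    (hz : hexNorm (z - center σ i) = 1) : z ∈ drawing (chain σ n) (chainPos σ n) := by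
  obtain ⟨k, hk⟩ := exists_mem_segment_of_hexNorm hz
  refine Or.inr ⟨chainCycle σ n i hi k, chainCycle σ n i hi (k + 1), cellCycle_adj σ i k, ?_⟩
  rwa [← ladderPos_cellCycle, ← ladderPos_cellCycle] at hk

lemma notMem_drawing_of_hexNorm_lt {n k : ℕ} (hn : 1 ≤ n) {z : ℂ}
    (hz : hexNorm (z - center σ k) < 1) : z ∉ drawing (chain σ n) (chainPos σ n) := by
  intro h
  obtain ⟨i, -, hi⟩ := exists_hexNorm_eq_of_mem_drawing hn h
  obtain rfl := eq_of_hexNorm_lt hi.le hz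
  exact hz.ne hi

/-- The component of a point inside a hexagon is the interior of the hexagon, since the frontier
of the hexagon is part of the drawing. -/
lemma connectedComponentIn_eq {n k : ℕ} (hk : k < n) {z : ℂ}
    (hz : hexNorm (z - center σ k) < 1) :
    connectedComponentIn (drawing (chain σ n) (chainPos σ n))ᶜ z =
      {w | hexNorm (w - center σ k) < 1} := by
  have hcont : Continuous fun w => hexNorm (w - center σ k) :=
    continuous_hexNorm.comp (by fun_prop)
  have hsub : {w | hexNorm (w - center σ k) < 1} ⊆ (drawing (chain σ n) (chainPos σ n))ᶜ :=
    fun w hw => notMem_drawing_of_hexNorm_lt (by omega) hw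
  refine Set.Subset.antisymm ?_ ?_
  · intro w hw
    by_contra hge
    have hpre : IsPreconnected (connectedComponentIn (drawing (chain σ n) (chainPos σ n))ᶜ z) :=
      isPreconnected_connectedComponentIn
    have hiv := hpre.intermediate_value (mem_connectedComponentIn (hsub hz)) hw
      hcont.continuousOn
    obtain ⟨p, hp, hp1⟩ := hiv ⟨hz.le, not_lt.1 hge⟩
    exact connectedComponentIn_subset _ _ hp (mem_drawing_of_hexNorm_eq hk hp1)
  · refine IsPreconnected.subset_connectedComponentIn ?_ hz hsub
    have hconv := hexNorm.convex_ball (center σ k) 1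
    have : hexNorm.ball (center σ k) 1 = {w | hexNorm (w - center σ k) < 1} :=
      Set.ext fun w => Seminorm.mem_ball _
    rw [this] at hconv
    exact hconv.isPreconnected

/-- The union of the closed hexagons meets every vertical line in a convex set: two hexagons over
the same abscissa are neighbours, and their common side is also over this abscissa. -/
lemma vertically_convex {n : ℕ} {z : ℂ} {i j : ℕ} (hi : i < n) (hj : j < n) {s t : ℝ}
    (hs : 0 ≤ s) (ht : 0 ≤ t)
    (h1 : hexNorm (z + (s : ℂ) * Complex.I - center σ i) ≤ 1)
    (h2 : hexNorm (z - (t : ℂ) * Complex.I - center σ j) ≤ 1) :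
    ∃ k < n, hexNorm (z - center σ k) ≤ 1 := by
  have ex1 : xCoord (z + (s : ℂ) * Complex.I) = xCoord z := by simp [xCoord_apply]
  have ex2 : xCoord (z - (t : ℂ) * Complex.I) = xCoord z := by simp [xCoord_apply]
  have ey1 : yCoord z ≤ yCoord (z + (s : ℂ) * Complex.I) := by
    simp only [yCoord_apply, Complex.add_im, Complex.mul_I_im, Complex.ofReal_re]
    gcongr; linarith
  have ey2 : yCoord (z - (t : ℂ) * Complex.I) ≤ yCoord z := by
    simp only [yCoord_apply, Complex.sub_im, Complex.mul_I_im, Complex.ofReal_re]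
    gcongr; linarith
  rw [hexNorm_le_iff, map_sub xCoord, map_sub yCoord, ex1, xCoord_center, yCoord_center] at h1
  rw [hexNorm_le_iff, map_sub xCoord, map_sub yCoord, ex2, xCoord_center, yCoord_center] at h2
  simp only [hexNorm_le_iff, map_sub, xCoord_center, yCoord_center]
  generalize yCoord (z + (s : ℂ) * Complex.I) = y1 at *
  generalize yCoord (z - (t : ℂ) * Complex.I) = y2 at *
  generalize yCoord z = y at *
  generalize xCoord z = x at *
  have h3 : (i : ℝ) < j + 2 := by linarith
  have h4 : (j : ℝ) < i + 2 := by linarith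
  have h3' : i < j + 2 := by exact_mod_cast h3
  have h4' : j < i + 2 := by exact_mod_cast h4
  obtain ⟨⟨a1, a2⟩, ⟨a3, a4⟩, a5, a6⟩ := h1
  obtain ⟨⟨b1, b2⟩, ⟨b3, b4⟩, b5, b6⟩ := h2
  -- Neighbouring hexagons are told apart by the line through their common side.
  rcases (by omega : i = j ∨ j = i + 1 ∨ i = j + 1) with rfl | rfl | rfl
  · exact ⟨i, hi, ⟨by linarith, by linarith⟩, ⟨by linarith, by linarith⟩, by linarith,
      by linarith⟩
  · push_cast at *
    rcases height_succ_cast σ (i + 1) with h | h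
    · rcases le_total (height σ (i + 1) + 2 - (x - 3 * i)) y with hy | hy
      · exact ⟨i, hi, ⟨by linarith, by linarith⟩, ⟨by linarith, by linarith⟩, by linarith,
          by linarith⟩
      · refine ⟨i + 1, hj, ?_⟩
        push_cast
        exact ⟨⟨by linarith, by linarith⟩, ⟨by linarith, by linarith⟩, by linarith, by linarith⟩
    · rcases le_total (height σ (i + 1) - 2 + (x - 3 * i)) y with hy | hy
      · exact ⟨i, hi, ⟨by linarith, by linarith⟩, ⟨by linarith, by linarith⟩, by linarith,
          by linarith⟩
      · refine ⟨i + 1, hj, ?_⟩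
        push_cast
        exact ⟨⟨by linarith, by linarith⟩, ⟨by linarith, by linarith⟩, by linarith, by linarith⟩
  · push_cast at *
    rcases height_succ_cast σ (j + 1) with h | h
    · rcases le_total y (height σ (j + 1) + 2 - (x - 3 * j)) with hy | hy
      · exact ⟨j, hj, ⟨by linarith, by linarith⟩, ⟨by linarith, by linarith⟩, by linarith,
          by linarith⟩
      · refine ⟨j + 1, hi, ?_⟩
        push_cast
        exact ⟨⟨by linarith, by linarith⟩, ⟨by linarith, by linarith⟩, by linarith, by linarith⟩
    · rcases le_total y (height σ (j + 1) - 2 + (x - 3 * j)) with hy | hy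
      · exact ⟨j, hj, ⟨by linarith, by linarith⟩, ⟨by linarith, by linarith⟩, by linarith,
          by linarith⟩
      · refine ⟨j + 1, hi, ?_⟩
        push_cast
        exact ⟨⟨by linarith, by linarith⟩, ⟨by linarith, by linarith⟩, by linarith, by linarith⟩

/-- A vertical ray, `e` being a direction `±i`, that avoids the drawing lies in an unbounded
component of its complement. -/
lemma not_isBounded_of_ray {n : ℕ} {z e : ℂ} (he : ‖e‖ = 1)
    (h : ∀ t : ℝ, 0 ≤ t → z + t * e ∉ drawing (chain σ n) (chainPos σ n)) :
    ¬ Bornology.IsBounded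
      (connectedComponentIn (drawing (chain σ n) (chainPos σ n))ᶜ z) := by
  intro hb
  have hray : (fun t : ℝ => z + t * e) '' Set.Ici 0 ⊆
      connectedComponentIn (drawing (chain σ n) (chainPos σ n))ᶜ z := by
    refine IsPreconnected.subset_connectedComponentIn ?_ ⟨0, Set.mem_Ici.2 le_rfl, by simp⟩ ?_
    · exact isPreconnected_Ici.image _ (by fun_prop)
    · rintro _ ⟨t, ht, rfl⟩
      exact h t ht
  obtain ⟨R, hR⟩ := (hb.subset hray).subset_closedBall z
  have hmem := hR ⟨|R| + 1, Set.mem_Ici.2 (by positivity), rfl⟩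
  rw [Metric.mem_closedBall, dist_eq_norm, add_sub_cancel_left, norm_mul, he, mul_one,
    Complex.norm_real, Real.norm_eq_abs, abs_of_nonneg (by positivity)] at hmem
  linarith [le_abs_self R]

lemma chain_face {n : ℕ} (hn : 1 ≤ n) {F : Set ℂ}
    (hF : F ∈ interiorFaces (chain σ n) (chainPos σ n)) :
    ∃ h : Fin 6 → ChainVertex σ n, IsHexagon (chain σ n) (chainPos σ n) h ∧
      F = interior (convexHull ℝ (Set.range (chainPos σ n ∘ h))) := by
  obtain ⟨hb, z, hz, rfl⟩ := hF
  by_cases hin : ∃ k < n, hexNorm (z - center σ k) ≤ 1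
  · obtain ⟨k, hk, hle⟩ := hin
    have hlt := lt_of_le_of_ne hle fun h => hz (mem_drawing_of_hexNorm_eq hk h)
    refine ⟨chainCycle σ n k hk, chainCycle_isHexagon σ n k hk, ?_⟩
    have : chainPos σ n ∘ chainCycle σ n k hk = hexVertex (center σ k) 1 :=
      funext fun l => ladderPos_cellCycle σ k l
    rw [connectedComponentIn_eq hk hlt, this, interior_hexagon]
  · exfalso
    by_cases hup : ∀ t : ℝ, 0 ≤ t → z + t * Complex.I ∉ drawing (chain σ n) (chainPos σ n)
    · exact not_isBounded_of_ray (by simp) hup hb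
    by_cases hdown : ∀ t : ℝ, 0 ≤ t → z + t * (-Complex.I) ∉ drawing (chain σ n) (chainPos σ n)
    · exact not_isBounded_of_ray (by simp) hdown hb
    push Not at hup hdown
    obtain ⟨s, hs, hsd⟩ := hup
    obtain ⟨t, ht, htd⟩ := hdown
    obtain ⟨i, hi, hi1⟩ := exists_hexNorm_eq_of_mem_drawing hn hsd
    obtain ⟨j, hj, hj1⟩ := exists_hexNorm_eq_of_mem_drawing hn htd
    rw [mul_neg, ← sub_eq_add_neg] at hj1
    exact hin (vertically_convex hi hj hs ht hi1.le hj1.le)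

/-- Chains with at least one hexagon are hexagonal systems. -/
theorem chain_isHexagonalSystem (σ : ℕ → Bool) {n : ℕ} (hn : 1 ≤ n) :
    IsHexagonalSystem (chain σ n) (chainPos σ n) where
  finite := inferInstance
  plane := chain_isPlane σ n
  connected := chain_connected σ n
  no_cut_vertex := chain_no_cut_vertex σ n
  face _ hF := chain_face hn hF

end

/-! ### Clar covers of a chain -/

/-- `Blocked σ K i`: some hexagon of `K` precedes the hexagon `i`, and no kink lies strictly
between them. Such a hexagon has already absorbed the left end of the rung `i` of any Clar cover
with hexagons `K`. -/
def Blocked (σ : ℕ → Bool) (K : Finset ℕ) : ℕ → Prop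
  | 0 => False
  | i + 1 => i ∈ K ∨ (Blocked σ K i ∧ σ i = σ (i + 1))

/-- Sets of hexagons any two of which are separated by a kink; these turn out to be the resonant
patterns. -/
def Admissible (σ : ℕ → Bool) (K : Finset ℕ) : Prop := ∀ i ∈ K, ¬ Blocked σ K i

lemma blocked_succ {σ : ℕ → Bool} {K : Finset ℕ} {i : ℕ} :
    Blocked σ K (i + 1) ↔ i ∈ K ∨ (Blocked σ K i ∧ σ i = σ (i + 1)) := Iff.rfl

lemma even_mem_cell {σ : ℕ → Bool} {i k : ℕ} {t : Bool} :
    (t, 2 * i) ∈ cell σ k ↔ (k = i ∧ t = σ i) ∨ i = k + 1 := by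
  rw [mem_cell]
  constructor
  · rintro (⟨rfl, h⟩ | h | h | ⟨-, h⟩)
    · obtain rfl : i = k := by omega
      exact Or.inl ⟨rfl, rfl⟩
    all_goals omega
  · rintro (⟨rfl, rfl⟩ | rfl)
    · exact Or.inl ⟨rfl, rfl⟩
    · omega

lemma odd_mem_cell {σ : ℕ → Bool} {i k : ℕ} {t : Bool} :
    (t, 2 * i + 1) ∈ cell σ k ↔ k = i ∨ (i = k + 1 ∧ t = !σ i) := by
  rw [mem_cell]
  constructor
  · rintro (⟨-, h⟩ | h | h | ⟨rfl, h⟩)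
    · omega
    · omega
    · omega
    · obtain rfl : i = k + 1 := by omega
      exact Or.inr ⟨rfl, rfl⟩
  · rintro (rfl | ⟨rfl, rfl⟩)
    · omega
    · exact Or.inr (Or.inr (Or.inr ⟨rfl, by omega⟩))

lemma cell_injective (σ : ℕ → Bool) : Function.Injective (cell σ) := by
  intro i k h
  have h1 : (σ i, 2 * i + 1) ∈ cell σ k := h ▸ odd_mem_cell.2 (Or.inl rfl)
  rcases odd_mem_cell.1 h1 with h1 | ⟨-, h1⟩
  · exact h1.symm
  · simp at h1

lemma chainCell_injOn (σ : ℕ → Bool) (n : ℕ) :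
    Set.InjOn (chainCell σ n) (Set.Iio n) := by
  intro i hi k hk h
  apply cell_injective σ
  ext a
  constructor <;> intro ha
  · exact (Set.ext_iff.1 h ⟨a, cell_subset_inChain hi ha⟩).1 ha
  · exact (Set.ext_iff.1 h ⟨a, cell_subset_inChain hk ha⟩).2 ha

section
variable {V : Type}

/-- A set that is closed under adjacency and whose elements are all reachable from `v` is the
component of `v`. -/
lemma supp_eq_of_closed {C : SimpleGraph V} {v : V} {S : Set V} (hv : v ∈ S)
    (hclosed : ∀ a ∈ S, ∀ b, C.Adj a b → b ∈ S) (hreach : ∀ a ∈ S, C.Reachable v a) :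
    (C.connectedComponentMk v).supp = S := by
  ext x
  rw [SimpleGraph.ConnectedComponent.mem_supp_iff, SimpleGraph.ConnectedComponent.eq]
  refine ⟨fun h => ?_, fun h => (hreach x h).symm⟩
  have h' := (SimpleGraph.reachable_iff_reflTransGen _ _).1 h.symm
  induction h' with
  | refl => exact hv
  | tail hab hbc ih =>
    exact hclosed _ (ih ((SimpleGraph.reachable_iff_reflTransGen _ _).2 hab).symm) _ hbc

lemma mem_supp_of_adj {C : SimpleGraph V} {c : C.ConnectedComponent} {a b : V}
    (ha : a ∈ c.supp) (hab : C.Adj a b) : b ∈ c.supp := by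
  rw [SimpleGraph.ConnectedComponent.mem_supp_iff] at *
  rw [← ha]
  exact SimpleGraph.ConnectedComponent.sound hab.reachable.symm

lemma IsHexagon.reachable {C : SimpleGraph V} {pos : V → ℂ} {h : Fin 6 → V}
    (hh : IsHexagon C pos h) (k : Fin 6) : C.Reachable (h 0) (h k) := by
  induction k using Fin.induction with
  | zero => exact SimpleGraph.Reachable.refl _
  | succ k ih =>
    have := (hh.2 k.castSucc).reachable
    rw [Fin.coeSucc_eq_succ] at this
    exact ih.trans this

lemma IsHexagon.mono {C G : SimpleGraph V} {pos : V → ℂ} {h : Fin 6 → V} (hle : C ≤ G)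
    (hh : IsHexagon C pos h) : IsHexagon G pos h :=
  ⟨hh.1, fun k => hle (hh.2 k)⟩

end

section
variable {σ : ℕ → Bool} {n : ℕ} {C : SimpleGraph (ChainVertex σ n)}

lemma IsHexagonComponent.exists_supp_eq (hle : C ≤ chain σ n) {c : C.ConnectedComponent}
    (hc : IsHexagonComponent C (chainPos σ n) c) : ∃ i < n, c.supp = chainCell σ n i := by
  obtain ⟨h, hh, hs, -⟩ := hc
  obtain ⟨i, hi, hr⟩ := (hh.mono hle).exists_range_eq
  exact ⟨i, hi, hs.trans hr⟩

/-- The leftmost vertex of a hexagon component has both of its neighbours in the next column, so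
one of them is the next vertex of the same side. -/
lemma adj_of_supp_eq (hle : C ≤ chain σ n) {c : C.ConnectedComponent} {m : ℕ}
    (hc : IsHexagonComponent C (chainPos σ n) c) (hs : c.supp = chainCell σ n m)
    (h1 : InChain σ n (σ m, 2 * m)) (h2 : InChain σ n (σ m, 2 * m + 1)) :
    C.Adj ⟨(σ m, 2 * m), h1⟩ ⟨(σ m, 2 * m + 1), h2⟩ := by
  obtain ⟨h, hh, hsr, -⟩ := hc
  have hmem : (⟨(σ m, 2 * m), h1⟩ : ChainVertex σ n) ∈ Set.range h := by
    rw [← hsr, hs]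
    exact even_mem_cell.2 (Or.inl ⟨rfl, rfl⟩)
  obtain ⟨k, hk⟩ := hmem
  have hcell : ∀ l, h l ∈ chainCell σ n m := fun l => by rw [← hs, hsr]; exact ⟨l, rfl⟩
  have key : ∀ w ∈ chainCell σ n m, C.Adj (h k) w → ∃ t, w.1 = (t, 2 * m + 1) := by
    rintro ⟨⟨t, j⟩, hv⟩ hw hl
    have hadj := hle hl
    rw [hk] at hadj
    have hge : 2 * m ≤ j := by
      rcases mem_cell.1 hw with h | h | h | h <;> omega
    rcases hadj with h | h
    · exact ⟨t, Prod.ext rfl h.1⟩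
    · have := h.1
      simp only at this
      omega
  obtain ⟨t, ht⟩ := key _ (hcell _) (hh.2 k)
  have hadj' : C.Adj (h k) (h (k - 1)) := by
    have := hh.2 (k - 1)
    rw [sub_add_cancel] at this
    exact this.symm
  obtain ⟨s, hs'⟩ := key _ (hcell _) hadj'
  have hne : h (k + 1) ≠ h (k - 1) := fun e => by
    have := IsHexagon.injective hh e
    revert this
    clear * -
    revert k
    decide
  have hts : t ≠ s := fun e => hne (Subtype.ext (by rw [ht, hs', e]))
  have hbool : ∀ t s r : Bool, t ≠ s → t ≠ r → s = r := by decide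
  rw [← hk]
  by_cases e : t = σ m
  · rw [show (⟨(σ m, 2 * m + 1), h2⟩ : ChainVertex σ n) = h (k + 1) from
      Subtype.ext (by rw [ht, e])]
    exact hh.2 k
  · rw [show (⟨(σ m, 2 * m + 1), h2⟩ : ChainVertex σ n) = h (k - 1) from
      Subtype.ext (by rw [hs', hbool t s _ hts e])]
    exact hadj'

open Classical in
/-- The hexagons of a Clar cover, as a set of indices. -/
noncomputable def coverIndices (C : SimpleGraph (ChainVertex σ n)) : Finset ℕ :=
  (Finset.range n).filter fun i => chainCell σ n i ∈ clarHexagons C (chainPos σ n)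

lemma mem_coverIndices {i : ℕ} : i ∈ coverIndices C ↔
    i < n ∧ ∃ c : C.ConnectedComponent, IsHexagonComponent C (chainPos σ n) c ∧
      c.supp = chainCell σ n i := by
  classical exact Finset.mem_filter.trans (and_congr Finset.mem_range Iff.rfl)

lemma clarHexagons_eq (hle : C ≤ chain σ n) :
    clarHexagons C (chainPos σ n) = chainCell σ n '' (coverIndices C : Finset ℕ) := by
  ext A
  constructor
  · rintro ⟨c, hc, rfl⟩
    obtain ⟨i, hi, hs⟩ := hc.exists_supp_eq hle
    exact ⟨i, mem_coverIndices.2 ⟨hi, c, hc, hs⟩, hs.symm⟩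
  · rintro ⟨i, hi, rfl⟩
    obtain ⟨-, c, hc, hs⟩ := mem_coverIndices.1 hi
    exact ⟨c, hc, hs⟩

/-- In a Clar cover, the left end of a blocked rung is matched to the left, or belongs to the
hexagon on its left. This propagates along a linear segment, since the vertices of the segment on
that side can only be matched forwards. -/
lemma not_adj_of_blocked (hC : IsClarCover (chain σ n) (chainPos σ n) C) (m : ℕ)
    (hb : Blocked σ (coverIndices C) m) (h1 : InChain σ n (σ m, 2 * m))
    (h2 : InChain σ n (σ m, 2 * m + 1)) :
    ¬ C.Adj ⟨(σ m, 2 * m), h1⟩ ⟨(σ m, 2 * m + 1), h2⟩ := by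
  induction m with
  | zero => exact hb.elim
  | succ m ih =>
    intro hadj
    have hmn : m < n := by have := h1.1; simp only at this; omega
    by_cases hm : m ∈ coverIndices C
    · obtain ⟨-, c, -, hs⟩ := mem_coverIndices.1 hm
      have hmem : (⟨(σ (m + 1), 2 * (m + 1)), h1⟩ : ChainVertex σ n) ∈ c.supp := by
        rw [hs]; exact even_mem_cell.2 (Or.inr rfl)
      have := mem_supp_of_adj hmem hadj
      rw [hs] at this
      rcases odd_mem_cell.1 this with h | ⟨-, h⟩
      · omega
      · simp at h
    obtain ⟨hbm, hlin⟩ := (blocked_succ.1 hb).resolve_left hm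
    have hv : InChain σ n (σ m, 2 * m + 1) :=
      cell_subset_inChain hmn (odd_mem_cell.2 (Or.inl rfl))
    have hu : InChain σ n (σ m, 2 * m) :=
      cell_subset_inChain hmn (even_mem_cell.2 (Or.inl ⟨rfl, rfl⟩))
    set x : ChainVertex σ n := ⟨(σ m, 2 * m + 1), hv⟩ with hx
    have hxc : x ∈ (C.connectedComponentMk x).supp := rfl
    -- The partner of `x` is the next vertex on the same side.
    have hpartner : ∀ w, C.Adj x w → w = ⟨(σ (m + 1), 2 * (m + 1)), h1⟩ := by
      intro w hw
      rcases hC.1 hw with hstep | hstep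
      · obtain ⟨⟨t, j⟩, hwv⟩ := w
        obtain rfl : j = 2 * m + 2 := hstep.1
        have := step_odd.1 hstep
        exact Subtype.ext (Prod.ext (this.symm.trans hlin) rfl)
      · exfalso
        obtain ⟨⟨t, j⟩, hwv⟩ := w
        obtain rfl : 2 * m = j := by have := hstep.1; simp only [hx] at this; omega
        have ht : t = σ m := (step_even.1 hstep).elim id id
        subst ht
        exact ih hbm hu hv hw.symm
    rcases hC.2 (C.connectedComponentMk x) with hhex | ⟨u, v, huv, hs⟩
    · obtain ⟨i, hi, hs⟩ := hhex.exists_supp_eq hC.1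
      have hxi := hxc
      rw [hs] at hxi
      rcases odd_mem_cell.1 hxi with rfl | ⟨-, h⟩
      · exact hm (mem_coverIndices.2 ⟨hi, _, hhex, hs⟩)
      · simp at h
    · obtain ⟨w, hw, hsw⟩ : ∃ w, C.Adj x w ∧ (C.connectedComponentMk x).supp = {x, w} := by
        have hxuv := hxc
        rw [hs] at hxuv
        rcases hxuv with h | h
        · exact ⟨v, by rw [h]; exact huv, by rw [hs, ← h]⟩
        · rw [Set.mem_singleton_iff] at h
          exact ⟨u, by rw [h]; exact huv.symm, by rw [hs, ← h, Set.pair_comm]⟩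
      obtain rfl := hpartner w hw
      have h3 := mem_supp_of_adj (mem_supp_of_adj hxc hw) hadj
      rw [hsw] at h3
      rcases h3 with h3 | h3
      · have := congrArg (fun v => v.1.2) h3
        simp only [hx] at this
        omega
      · have := congrArg (fun v => v.1.2) (Set.mem_singleton_iff.1 h3)
        simp only at this
        omega

/-- The hexagons of a Clar cover are separated by kinks. -/
lemma admissible_coverIndices (hC : IsClarCover (chain σ n) (chainPos σ n) C) :
    Admissible σ (coverIndices C) := by
  intro m hm hb
  obtain ⟨hmn, c, hc, hs⟩ := mem_coverIndices.1 hm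
  have hv : InChain σ n (σ m, 2 * m + 1) :=
    cell_subset_inChain hmn (odd_mem_cell.2 (Or.inl rfl))
  have hu : InChain σ n (σ m, 2 * m) :=
    cell_subset_inChain hmn (even_mem_cell.2 (Or.inl ⟨rfl, rfl⟩))
  exact not_adj_of_blocked hC m hb hu hv (adj_of_supp_eq hC.1 hc hs hu hv)

end

/-! ### Clar covers with given hexagons -/

open Classical in
/-- The partner of a vertex outside the hexagons of `K`, in the perfect matching of the remaining
vertices. On a linear segment the vertices are matched forwards after a hexagon of `K` and
backwards before it; a kink allows the change from the former to the latter. -/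
noncomputable def mate (σ : ℕ → Bool) (K : Finset ℕ) (a : Bool × ℕ) : Bool × ℕ :=
  if a.2 % 2 = 0 then
    if a.1 = σ (a.2 / 2) then
      if Blocked σ K (a.2 / 2) then (a.1, a.2 - 1)
      else if σ (a.2 / 2) = σ (a.2 / 2 + 1) then (a.1, a.2 + 1) else (!a.1, a.2 + 1)
    else if Blocked σ K (a.2 / 2) then (a.1, a.2 + 1) else (a.1, a.2 - 1)
  else
    if a.1 = σ (a.2 / 2) then
      if σ (a.2 / 2) = σ (a.2 / 2 + 1) ∧ ¬ Blocked σ K (a.2 / 2) then (a.1, a.2 - 1)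
      else (a.1, a.2 + 1)
    else if Blocked σ K (a.2 / 2) then (a.1, a.2 - 1)
      else if σ (a.2 / 2) = σ (a.2 / 2 + 1) then (a.1, a.2 + 1) else (!a.1, a.2 - 1)

open Classical in
lemma mate_even (σ : ℕ → Bool) (K : Finset ℕ) (t : Bool) (i : ℕ) : mate σ K (t, 2 * i) =
    if t = σ i then
      if Blocked σ K i then (t, 2 * i - 1)
      else if σ i = σ (i + 1) then (t, 2 * i + 1) else (!t, 2 * i + 1)
    else if Blocked σ K i then (t, 2 * i + 1) else (t, 2 * i - 1) := by
  have h1 : 2 * i % 2 = 0 := by omega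
  have h2 : 2 * i / 2 = i := by omega
  simp only [mate, h1, h2, if_true]

open Classical in
lemma mate_odd (σ : ℕ → Bool) (K : Finset ℕ) (t : Bool) (i : ℕ) : mate σ K (t, 2 * i + 1) =
    if t = σ i then
      if σ i = σ (i + 1) ∧ ¬ Blocked σ K i then (t, 2 * i) else (t, 2 * i + 2)
    else if Blocked σ K i then (t, 2 * i)
      else if σ i = σ (i + 1) then (t, 2 * i + 2) else (!t, 2 * i) := by
  have h1 : ¬ (2 * i + 1) % 2 = 0 := by omega
  have h2 : (2 * i + 1) / 2 = i := by omega
  simp only [mate, h2, if_neg h1, Nat.add_sub_cancel]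

/-- The vertices outside the hexagons of `K`. -/
def Free (σ : ℕ → Bool) (K : Finset ℕ) (a : Bool × ℕ) : Prop := ∀ i ∈ K, a ∉ cell σ i

section
variable {σ : ℕ → Bool} {n : ℕ} {K : Finset ℕ}

lemma free_even {t : Bool} {i : ℕ} : Free σ K (t, 2 * i) ↔
    (t = σ i → i ∉ K) ∧ ∀ k, i = k + 1 → k ∉ K := by
  simp only [Free, even_mem_cell]
  constructor
  · exact fun h => ⟨fun ht hi => h i hi (Or.inl ⟨rfl, ht⟩), fun k hk hkK => h k hkK (Or.inr hk)⟩
  · rintro ⟨h1, h2⟩ k hk (⟨rfl, ht⟩ | h)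
    · exact h1 ht hk
    · exact h2 k h hk

lemma free_odd {t : Bool} {i : ℕ} : Free σ K (t, 2 * i + 1) ↔
    i ∉ K ∧ ∀ k, i = k + 1 → t = (!σ i) → k ∉ K := by
  simp only [Free, odd_mem_cell]
  constructor
  · exact fun h => ⟨fun hi => h i hi (Or.inl rfl), fun k hk ht hkK => h k hkK (Or.inr ⟨hk, ht⟩)⟩
  · rintro ⟨h1, h2⟩ k hk (rfl | ⟨h, ht⟩)
    · exact h1 hk
    · exact h2 k h ht hk

lemma inChain_even {t : Bool} {i : ℕ} : InChain σ n (t, 2 * i) ↔ i ≤ n ∧ (i = 0 → t = σ 0) := by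
  simp only [InChain]
  constructor
  · exact fun h => ⟨by omega, fun hi => h.2.1 (by omega)⟩
  · exact fun h => ⟨by omega, fun hi => h.2 (by omega), fun hi => by omega⟩

lemma inChain_odd {t : Bool} {i : ℕ} :
    InChain σ n (t, 2 * i + 1) ↔ i ≤ n ∧ (i = n → t = !σ n) := by
  simp only [InChain]
  constructor
  · exact fun h => ⟨by omega, fun hi => h.2.2 (by omega)⟩
  · exact fun h => ⟨by omega, fun hi => by omega, fun hi => h.2 (by omega)⟩

/-- Assuming that the last rung is followed by a kink, so that it is matched to itself unless it
is blocked, `mate` is a perfect matching of the free vertices. -/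
lemma mate_spec (hK : Admissible σ K) (hσ : σ n ≠ σ (n + 1))
    {a : Bool × ℕ} (ha : InChain σ n a) (hf : Free σ K a) :
    InChain σ n (mate σ K a) ∧ Free σ K (mate σ K a) ∧
      (Step σ a (mate σ K a) ∨ Step σ (mate σ K a) a) ∧ mate σ K (mate σ K a) = a := by
  obtain ⟨t, j⟩ := a
  obtain ⟨i, rfl | rfl⟩ := Nat.even_or_odd' j
  · rw [inChain_even] at ha
    rw [free_even] at hf
    obtain ⟨hin, hi0⟩ := ha
    obtain ⟨hf1, hf2⟩ := hf
    by_cases ht : t = σ i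
    · by_cases hb : Blocked σ K i
      · obtain _ | k := i
        · exact hb.elim
        have hkb := (blocked_succ.1 hb).resolve_left (hf2 k rfl)
        have htk : t = σ k := by rw [ht, hkb.2]
        have e : mate σ K (t, 2 * (k + 1)) = (t, 2 * k + 1) := by
          rw [mate_even, if_pos ht, if_pos hb]; rfl
        rw [e, inChain_odd, free_odd, mate_odd, if_pos htk,
          if_neg (fun h => h.2 hkb.1)]
        exact ⟨⟨by omega, by omega⟩, ⟨hf2 k rfl, fun l _ h => by simp [htk] at h⟩,
          Or.inr (step_odd.2 rfl), rfl⟩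
      · by_cases hl : σ i = σ (i + 1)
        · have e : mate σ K (t, 2 * i) = (t, 2 * i + 1) := by
            rw [mate_even, if_pos ht, if_neg hb, if_pos hl]
          rw [e, inChain_odd, free_odd, mate_odd, if_pos ht, if_pos ⟨hl, hb⟩]
          exact ⟨⟨hin, fun h => absurd (h ▸ hl) hσ⟩, ⟨hf1 ht, fun l _ h => by simp [ht] at h⟩,
            Or.inl (step_even.2 (Or.inl rfl)), rfl⟩
        · have e : mate σ K (t, 2 * i) = (!t, 2 * i + 1) := by
            rw [mate_even, if_pos ht, if_neg hb, if_neg hl]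
          have hne : (!t) ≠ σ i := by simp [ht]
          rw [e, inChain_odd, free_odd, mate_odd, if_neg hne, if_neg hb, if_neg hl, Bool.not_not]
          exact ⟨⟨hin, fun h => by rw [ht, h]⟩, ⟨hf1 ht, fun l h _ => hf2 l h⟩,
            Or.inl (step_even.2 (Or.inr ht)), rfl⟩
    · have htn := Bool.eq_not.2 ht
      obtain _ | k := i
      · exact absurd (hi0 rfl) ht
      have hk := hf2 k rfl
      by_cases hb : Blocked σ K (k + 1)
      · have e : mate σ K (t, 2 * (k + 1)) = (t, 2 * (k + 1) + 1) := by
          rw [mate_even, if_neg ht, if_pos hb]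
        rw [e, inChain_odd, free_odd, mate_odd, if_neg ht, if_pos hb]
        exact ⟨⟨hin, fun h => by rw [htn, h]⟩, ⟨fun h => hK _ h hb, fun l h _ => hf2 l h⟩,
          Or.inl (step_even.2 (Or.inl rfl)), rfl⟩
      · have e : mate σ K (t, 2 * (k + 1)) = (t, 2 * k + 1) := by
          rw [mate_even, if_neg ht, if_neg hb]; rfl
        have hnb : ¬ (Blocked σ K k ∧ σ k = σ (k + 1)) := fun h => hb (Or.inr h)
        have hback : mate σ K (t, 2 * k + 1) = (t, 2 * k + 2) := by
          rw [mate_odd]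
          by_cases htk : t = σ k
          · rw [if_pos htk, if_neg]
            exact fun h => ht (htk.trans h.1)
          · have hl : σ k = σ (k + 1) := by
              rw [Bool.eq_not.2 (Ne.symm htk), htn, Bool.not_not]
            rw [if_neg htk, if_neg fun h => hnb ⟨h, hl⟩, if_pos hl]
        rw [e, inChain_odd, free_odd, hback]
        refine ⟨⟨by omega, by omega⟩, ⟨hk, fun l hl h hlK => ?_⟩, Or.inr (step_odd.2 rfl), rfl⟩
        refine hnb ⟨hl ▸ Or.inl hlK, ?_⟩
        rw [htn] at h
        simpa using h.symm
  · rw [inChain_odd] at ha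
    rw [free_odd] at hf
    obtain ⟨hin, hi0⟩ := ha
    obtain ⟨hf1, hf2⟩ := hf
    -- The next vertex of the same side, when `a` is matched forwards.
    have hforward : i < n → Blocked σ K (i + 1) ∧ t = σ (i + 1) ∧ i + 1 ∉ K ∨
        ¬ Blocked σ K (i + 1) ∧ t ≠ σ (i + 1) →
        mate σ K (t, 2 * i + 1) = (t, 2 * i + 2) →
        InChain σ n (mate σ K (t, 2 * i + 1)) ∧ Free σ K (mate σ K (t, 2 * i + 1)) ∧
        (Step σ (t, 2 * i + 1) (mate σ K (t, 2 * i + 1)) ∨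
          Step σ (mate σ K (t, 2 * i + 1)) (t, 2 * i + 1)) ∧
        mate σ K (mate σ K (t, 2 * i + 1)) = (t, 2 * i + 1) := by
      intro hlt hcase e
      rw [e]
      refine ⟨(inChain_even (i := i + 1)).2 ⟨hlt, by omega⟩,
        (free_even (i := i + 1)).2 ⟨?_, fun k hk => ?_⟩, Or.inl (step_odd.2 rfl), ?_⟩
      · rcases hcase with h | h
        · exact fun _ => h.2.2
        · exact fun h' => absurd h' h.2
      · obtain rfl : k = i := by omega
        exact hf1
      · change mate σ K (t, 2 * (i + 1)) = _
        rw [mate_even]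
        rcases hcase with h | h
        · rw [if_pos h.2.1, if_pos h.1]; rfl
        · rw [if_neg h.2, if_neg h.1]; rfl
    by_cases ht : t = σ i
    · have hlt : i < n := by
        refine lt_of_le_of_ne hin fun h => ?_
        have := hi0 h
        rw [ht, h] at this
        simp at this
      by_cases hl : σ i = σ (i + 1) ∧ ¬ Blocked σ K i
      · have e : mate σ K (t, 2 * i + 1) = (t, 2 * i) := by
          rw [mate_odd, if_pos ht, if_pos hl]
        rw [e, inChain_even, free_even, mate_even, if_pos ht, if_neg hl.2, if_pos hl.1]
        exact ⟨⟨hin, fun h => by rw [ht, h]⟩, ⟨fun _ => hf1, fun k hk hkK =>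
          hl.2 (hk ▸ Or.inl hkK)⟩, Or.inr (step_even.2 (Or.inl rfl)), rfl⟩
      · refine hforward hlt ?_ (by rw [mate_odd, if_pos ht, if_neg hl])
        by_cases hlin : σ i = σ (i + 1)
        · have hb : Blocked σ K (i + 1) := Or.inr ⟨by_contra fun h => hl ⟨hlin, h⟩, hlin⟩
          exact Or.inl ⟨hb, ht.trans hlin, fun h => hK _ h hb⟩
        · exact Or.inr ⟨fun h => (blocked_succ.1 h).elim hf1 fun h => hlin h.2,
            fun h => hlin (ht.symm.trans h)⟩
    · have htn := Bool.eq_not.2 ht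
      by_cases hb : Blocked σ K i
      · have e : mate σ K (t, 2 * i + 1) = (t, 2 * i) := by
          rw [mate_odd, if_neg ht, if_pos hb]
        rw [e, inChain_even, free_even, mate_even, if_neg ht, if_pos hb]
        exact ⟨⟨hin, fun h => by subst h; exact hb.elim⟩,
          ⟨fun h => absurd h ht, fun k hk => hf2 k hk htn⟩,
          Or.inr (step_even.2 (Or.inl rfl)), rfl⟩
      · by_cases hl : σ i = σ (i + 1)
        · have hlt : i < n := lt_of_le_of_ne hin fun h => hσ (h ▸ hl)
          refine hforward hlt (Or.inr ⟨fun h => (blocked_succ.1 h).elim hf1 fun h => hb h.1,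
            fun h => ht (h.trans hl.symm)⟩) (by rw [mate_odd, if_neg ht, if_neg hb, if_pos hl])
        · have e : mate σ K (t, 2 * i + 1) = (!t, 2 * i) := by
            rw [mate_odd, if_neg ht, if_neg hb, if_neg hl]
          have ht' : (!t) = σ i := by rw [htn, Bool.not_not]
          rw [e, inChain_even, free_even, mate_even, if_pos ht', if_neg hb, if_neg hl,
            Bool.not_not]
          exact ⟨⟨hin, fun h => by rw [ht', h]⟩, ⟨fun _ => hf1, fun k hk hkK =>
            hb (hk ▸ Or.inl hkK)⟩, Or.inr (step_even.2 (Or.inr ht')), rfl⟩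

end

section
variable {σ : ℕ → Bool} {n : ℕ} {K : Finset ℕ}

/-- The hexagons of an admissible set are pairwise disjoint. -/
lemma Admissible.eq_of_mem (hK : Admissible σ K) {i k : ℕ} (hi : i ∈ K) (hk : k ∈ K) {a : Bool × ℕ}
    (hai : a ∈ cell σ i) (hak : a ∈ cell σ k) : i = k := by
  have hcol : ∀ i, a ∈ cell σ i → 2 * i ≤ a.2 ∧ a.2 ≤ 2 * i + 3 := by
    obtain ⟨t, j⟩ := a
    intro i h
    rcases mem_cell.1 h with h | h | h | h <;> simp only <;> omega
  have h1 := hcol i hai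
  have h2 := hcol k hak
  rcases (by omega : i = k ∨ k = i + 1 ∨ i = k + 1) with rfl | rfl | rfl
  · rfl
  · exact absurd (Or.inl hi) (hK _ hk)
  · exact absurd (Or.inl hk) (hK _ hi)

/-- The Clar cover with hexagons `K` in which the other vertices are matched by `mate`. -/
def cover (hK : Admissible σ K) (hσ : σ n ≠ σ (n + 1)) : SimpleGraph (ChainVertex σ n) where
  Adj a b := (∃ i ∈ K, a.1 ∈ cell σ i ∧ b.1 ∈ cell σ i ∧ (chain σ n).Adj a b) ∨
    (Free σ K a.1 ∧ b.1 = mate σ K a.1)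
  symm := ⟨by
    rintro a b (⟨i, hi, ha, hb, h⟩ | ⟨hf, h⟩)
    · exact Or.inl ⟨i, hi, hb, ha, h.symm⟩
    · obtain ⟨-, h2, -, h4⟩ := mate_spec hK hσ a.2 hf
      exact Or.inr ⟨h ▸ h2, by rw [h, h4]⟩⟩
  loopless := ⟨by
    rintro a (⟨i, hi, ha, hb, h⟩ | ⟨hf, h⟩)
    · exact h.ne rfl
    · obtain ⟨-, -, h3, -⟩ := mate_spec hK hσ a.2 hf
      rw [← h] at h3
      rcases h3 with h3 | h3 <;> exact absurd h3.1 (by omega)⟩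

variable (hK : Admissible σ K) (hσ : σ n ≠ σ (n + 1))

lemma cover_le : cover hK hσ ≤ chain σ n := by
  rintro a b (⟨i, -, -, -, h⟩ | ⟨hf, h⟩)
  · exact h
  · have h3 := (mate_spec hK hσ a.2 hf).2.2.1
    rw [← h] at h3
    exact h3

lemma cover_adj_of_free {a b : ChainVertex σ n} (ha : Free σ K a.1) :
    (cover hK hσ).Adj a b ↔ b.1 = mate σ K a.1 :=
  ⟨fun h => h.elim (fun ⟨i, hi, hai, _⟩ => absurd hai (ha i hi)) And.right, fun h => Or.inr ⟨ha, h⟩⟩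

lemma cover_adj_of_mem {a b : ChainVertex σ n} {i : ℕ} (hi : i ∈ K) (ha : a.1 ∈ cell σ i) :
    (cover hK hσ).Adj a b ↔ b.1 ∈ cell σ i ∧ (chain σ n).Adj a b := by
  constructor
  · rintro (⟨k, hk, hak, hbk, h⟩ | ⟨hf, -⟩)
    · obtain rfl := hK.eq_of_mem hi hk ha hak
      exact ⟨hbk, h⟩
    · exact absurd ha (hf i hi)
  · exact fun h => Or.inl ⟨i, hi, ha, h.1, h.2⟩

lemma cover_supp_of_free {a : ChainVertex σ n} (ha : Free σ K a.1) :
    ∃ b, (cover hK hσ).Adj a b ∧ ((cover hK hσ).connectedComponentMk a).supp = {a, b} := by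
  obtain ⟨h1, h2, h3, h4⟩ := mate_spec hK hσ a.2 ha
  have hadj : (cover hK hσ).Adj a ⟨mate σ K a.1, h1⟩ := (cover_adj_of_free hK hσ ha).2 rfl
  refine ⟨⟨mate σ K a.1, h1⟩, hadj, supp_eq_of_closed (Or.inl rfl) ?_ ?_⟩
  · rintro x (rfl | rfl) b hb
    · exact Or.inr (Subtype.ext ((cover_adj_of_free hK hσ ha).1 hb))
    · refine Or.inl (Subtype.ext ?_)
      rw [(cover_adj_of_free hK hσ h2).1 hb]
      exact h4
  · rintro x (rfl | rfl)
    · exact SimpleGraph.Reachable.refl _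
    · exact hadj.reachable

lemma cover_isHexagon {i : ℕ} (hi : i ∈ K) (hin : i < n) :
    IsHexagon (cover hK hσ) (chainPos σ n) (chainCycle σ n i hin) := by
  refine ⟨(chainCycle_isHexagon σ n i hin).1, fun k => ?_⟩
  have hmem : ∀ k, (chainCycle σ n i hin k).1 ∈ cell σ i := fun k => by
    rw [← range_cellCycle]; exact ⟨k, rfl⟩
  exact (cover_adj_of_mem hK hσ hi (hmem k)).2 ⟨hmem _, cellCycle_adj σ i k⟩

lemma cover_supp_of_mem {a : ChainVertex σ n} {i : ℕ} (hi : i ∈ K) (hin : i < n)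
    (ha : a.1 ∈ cell σ i) :
    ((cover hK hσ).connectedComponentMk a).supp = chainCell σ n i := by
  refine supp_eq_of_closed ha (fun x hx b hb => ((cover_adj_of_mem hK hσ hi hx).1 hb).1) ?_
  have hr : ∀ x ∈ chainCell σ n i, (cover hK hσ).Reachable (chainCycle σ n i hin 0) x := by
    intro x hx
    rw [← range_chainCycle σ n i hin] at hx
    obtain ⟨k, rfl⟩ := hx
    exact (cover_isHexagon hK hσ hi hin).reachable k
  exact fun x hx => (hr a ha).symm.trans (hr x hx)

lemma cover_isHexagonComponent {a : ChainVertex σ n} {i : ℕ} (hi : i ∈ K) (hin : i < n)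
    (ha : a.1 ∈ cell σ i) :
    IsHexagonComponent (cover hK hσ) (chainPos σ n) ((cover hK hσ).connectedComponentMk a) := by
  refine ⟨chainCycle σ n i hin, cover_isHexagon hK hσ hi hin, ?_, fun k l h => ?_⟩
  · rw [cover_supp_of_mem hK hσ hi hin ha, range_chainCycle]
  · rcases cover_le hK hσ h with h | h
    · exact cellCycle_adj_imp h
    · exact (cellCycle_adj_imp h).symm

lemma cover_isClarCover (hKn : ∀ i ∈ K, i < n) :
    IsClarCover (chain σ n) (chainPos σ n) (cover hK hσ) := by
  refine ⟨cover_le hK hσ, fun c => ?_⟩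
  induction c using SimpleGraph.ConnectedComponent.ind with | _ a => ?_
  by_cases hf : Free σ K a.1
  · obtain ⟨b, hab, hs⟩ := cover_supp_of_free hK hσ hf
    exact Or.inr ⟨a, b, hab, hs⟩
  · rw [Free] at hf
    push Not at hf
    obtain ⟨i, hi, ha⟩ := hf
    exact Or.inl (cover_isHexagonComponent hK hσ hi (hKn i hi) ha)

lemma coverIndices_cover (hKn : ∀ i ∈ K, i < n) : coverIndices (cover hK hσ) = K := by
  ext i
  rw [mem_coverIndices]
  constructor
  · rintro ⟨hin, c, -, hs⟩
    have hmem : ∀ k, chainCycle σ n i hin k ∈ c.supp := fun k => by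
      rw [hs, ← range_chainCycle σ n i hin]; exact ⟨k, rfl⟩
    have hc : (cover hK hσ).connectedComponentMk (chainCycle σ n i hin 1) = c := hmem 1
    have hne : ∀ k l, k ≠ l → chainCycle σ n i hin k ≠ chainCycle σ n i hin l :=
      fun k l hkl h => hkl (IsHexagon.injective (chainCycle_isHexagon σ n i hin) h)
    by_cases hf : Free σ K (chainCycle σ n i hin 1).1
    · -- The component would have two elements only.
      exfalso
      obtain ⟨b, -, hb⟩ := cover_supp_of_free hK hσ hf
      rw [hc] at hb
      have h2 := hmem 2
      have h3 := hmem 3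
      rw [hb] at h2 h3
      have e2 := h2.resolve_left (hne 2 1 (by decide))
      have e3 := h3.resolve_left (hne 3 1 (by decide))
      exact hne 2 3 (by decide) (e2.trans e3.symm)
    · rw [Free] at hf
      push Not at hf
      obtain ⟨k, hk, ha⟩ := hf
      have hs' := cover_supp_of_mem hK hσ hk (hKn k hk) ha
      rw [hc, hs] at hs'
      rwa [chainCell_injOn σ n hin (hKn k hk) hs']
  · intro hi
    have ha : (chainCycle σ n i (hKn i hi) 0).1 ∈ cell σ i := by
      rw [← range_cellCycle]; exact ⟨0, rfl⟩
    exact ⟨hKn i hi, _, cover_isHexagonComponent hK hσ hi (hKn i hi) ha,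
      cover_supp_of_mem hK hσ hi (hKn i hi) ha⟩

end

/-- The resonant patterns of a chain are the admissible sets of hexagons. -/
theorem mem_resonantPatterns_chain {σ : ℕ → Bool} {n : ℕ} (hσ : σ n ≠ σ (n + 1))
    {A : Set (Set (ChainVertex σ n))} :
    A ∈ resonantPatterns (chain σ n) (chainPos σ n) ↔
      ∃ K : Finset ℕ, (∀ i ∈ K, i < n) ∧ Admissible σ K ∧ A = chainCell σ n '' K := by
  constructor
  · rintro ⟨C, hC, rfl⟩
    exact ⟨coverIndices C, fun i hi => (mem_coverIndices.1 hi).1, admissible_coverIndices hC,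
      clarHexagons_eq hC.1⟩
  · rintro ⟨K, hKn, hK, rfl⟩
    refine ⟨cover hK hσ, cover_isClarCover hK hσ hKn, ?_⟩
    rw [clarHexagons_eq (cover_le hK hσ), coverIndices_cover hK hσ hKn]

lemma chain_exists_isPerfectMatching {σ : ℕ → Bool} {n : ℕ} (hσ : σ n ≠ σ (n + 1)) :
    ∃ M : (chain σ n).Subgraph, M.IsPerfectMatching := by
  have hK : Admissible σ ∅ := fun i hi => absurd hi (Finset.notMem_empty i)
  refine ⟨SimpleGraph.toSubgraph (cover hK hσ) (cover_le hK hσ),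
    SimpleGraph.Subgraph.isPerfectMatching_iff.2 fun v => ?_⟩
  have hf : Free σ ∅ v.1 := fun i hi => absurd hi (Finset.notMem_empty i)
  refine ⟨⟨mate σ ∅ v.1, (mate_spec hK hσ v.2 hf).1⟩, (cover_adj_of_free hK hσ hf).2 rfl,
    fun w hw => Subtype.ext ((cover_adj_of_free hK hσ hf).1 hw)⟩

open Classical in
/-- The admissible sets of hexagons among the first `n`. -/
noncomputable def admissibleSets (σ : ℕ → Bool) (n : ℕ) : Finset (Finset ℕ) :=
  (Finset.range n).powerset.filter (Admissible σ)

lemma mem_admissibleSets {σ : ℕ → Bool} {n : ℕ} {K : Finset ℕ} :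
    K ∈ admissibleSets σ n ↔ (∀ i ∈ K, i < n) ∧ Admissible σ K := by
  simp [admissibleSets, Finset.subset_iff]

theorem eval_sextetPolynomial_chain {σ : ℕ → Bool} {n : ℕ} (hσ : σ n ≠ σ (n + 1)) (r : ℝ) :
    (sextetPolynomial (chain σ n) (chainPos σ n)).eval r =
      ∑ K ∈ admissibleSets σ n, r ^ K.card := by
  rw [eval_sextetPolynomial]
  symm
  have hinj : ∀ K ∈ admissibleSets σ n, Set.InjOn (chainCell σ n) (K : Set ℕ) := fun K hK =>
    (chainCell_injOn σ n).mono fun i hi => (mem_admissibleSets.1 hK).1 i hi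
  refine Finset.sum_bij (fun K _ => chainCell σ n '' (K : Set ℕ)) ?_ ?_ ?_ ?_
  · intro K hK
    obtain ⟨h1, h2⟩ := mem_admissibleSets.1 hK
    exact (Set.Finite.mem_toFinset _).2 ((mem_resonantPatterns_chain hσ).2 ⟨K, h1, h2, rfl⟩)
  · intro K hK L hL h
    have hsub : ∀ K ∈ admissibleSets σ n, (K : Set ℕ) ⊆ Set.Iio n := fun K hK i hi =>
      (mem_admissibleSets.1 hK).1 i hi
    exact Finset.coe_injective
      (((chainCell_injOn σ n).image_eq_image_iff (hsub K hK) (hsub L hL)).1 h)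
  · intro A hA
    obtain ⟨K, h1, h2, rfl⟩ :=
      (mem_resonantPatterns_chain hσ).1 ((Set.Finite.mem_toFinset _).1 hA)
    exact ⟨K, mem_admissibleSets.2 ⟨h1, h2⟩, rfl⟩
  · intro K hK
    rw [(hinj K hK).ncard_image, Set.ncard_coe_finset]

/-! ### The sign of the zeros -/

section
variable {V : Type}

/-- A perfect matching is a Clar cover without hexagons. -/
lemma empty_mem_resonantPatterns {G : SimpleGraph V} {pos : V → ℂ} {M : G.Subgraph}
    (hM : M.IsPerfectMatching) : (∅ : Set (Set V)) ∈ resonantPatterns G pos := by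
  have hM' := SimpleGraph.Subgraph.isPerfectMatching_iff.1 hM
  refine ⟨M.spanningCoe, ⟨M.spanningCoe_le, fun c => Or.inr ?_⟩, ?_⟩
  · induction c using SimpleGraph.ConnectedComponent.ind with | _ v => ?_
    obtain ⟨w, hw, huniq⟩ := hM' v
    have hw' : M.spanningCoe.Adj v w := hw
    refine ⟨v, w, hw, Set.Subset.antisymm ?_ ?_⟩
    · intro x hx
      have hreach : M.spanningCoe.Reachable v x :=
        (SimpleGraph.ConnectedComponent.exact hx).symm
      rw [SimpleGraph.reachable_iff_reflTransGen] at hreach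
      induction hreach with
      | refl => exact Or.inl rfl
      | tail hvb hbc ih =>
        rename_i b c'
        have hb : b ∈ ({v, w} : Set V) := ih (by
          rw [SimpleGraph.ConnectedComponent.mem_supp_iff, SimpleGraph.ConnectedComponent.eq]
          exact ((SimpleGraph.reachable_iff_reflTransGen _ _).2 hvb).symm)
        rcases hb with rfl | rfl
        · exact Or.inr (huniq _ hbc)
        · exact Or.inl ((hM' b).unique hbc hw.symm)
    · rintro x (rfl | rfl)
      · rfl
      · exact SimpleGraph.ConnectedComponent.sound hw'.reachable.symm
  · symm
    rw [Set.eq_empty_iff_forall_notMem]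
    rintro A ⟨c, ⟨h, hh, -⟩, -⟩
    have h02 : h 0 = h 2 := (hM' (h 1)).unique (hh.2 0).symm (hh.2 1)
    exact absurd (IsHexagon.injective hh h02) (by decide)

/-- The coefficients are nonnegative and the constant one is positive, so no zero is positive. -/
lemma IsRealSextetZero.nonpos {r : ℝ} (hr : IsRealSextetZero r) : r ≤ 0 := by
  obtain ⟨V, G, pos, hG, ⟨M, hM⟩, hroot⟩ := hr
  have := hG.finite
  by_contra! hpos
  rw [Polynomial.IsRoot, eval_sextetPolynomial] at hroot
  have h1 := (Finset.sum_eq_zero_iff_of_nonneg fun K _ => by positivity).1 hroot ∅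
    ((Set.Finite.mem_toFinset _).2 (empty_mem_resonantPatterns hM))
  simp at h1

end

/-! ### Counting the resonant patterns of a chain -/

section
variable {σ : ℕ → Bool} {n : ℕ} {K : Finset ℕ}

lemma blocked_insert {m : ℕ} (hm : m ≤ n) : Blocked σ (insert n K) m ↔ Blocked σ K m := by
  induction m with
  | zero => exact Iff.rfl
  | succ m ih =>
    rw [blocked_succ, blocked_succ, ih (by omega), Finset.mem_insert,
      or_iff_right (by omega : m ≠ n)]

lemma admissible_insert (hK : ∀ i ∈ K, i < n) :
    Admissible σ (insert n K) ↔ Admissible σ K ∧ ¬ Blocked σ K n := by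
  simp only [Admissible, Finset.mem_insert, forall_eq_or_imp]
  rw [blocked_insert le_rfl, and_comm]
  refine and_congr_left fun _ => forall₂_congr fun i hi => ?_
  rw [blocked_insert (hK i hi).le]

open Classical in
/-- An admissible set of the first `n + 1` hexagons either avoids the last one, or contains it and
does not otherwise block its left rung. -/
lemma sum_admissibleSets_succ (f : Finset ℕ → ℝ) :
    ∑ K ∈ admissibleSets σ (n + 1), f K = ∑ K ∈ admissibleSets σ n, f K +
      ∑ K ∈ admissibleSets σ n, if Blocked σ K n then 0 else f (insert n K) := by
  simp only [admissibleSets, Finset.sum_filter]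
  rw [Finset.range_add_one, Finset.sum_powerset_insert Finset.notMem_range_self]
  congr 1
  refine Finset.sum_congr rfl fun K hK => ?_
  have hK' : ∀ i ∈ K, i < n := fun i hi => Finset.mem_range.1 (Finset.mem_powerset.1 hK hi)
  simp only [admissible_insert hK']
  by_cases h1 : Admissible σ K <;> by_cases h2 : Blocked σ K n <;> simp [h1, h2]

open Classical in
/-- The generating function of the admissible sets that do not block the rung `n`. -/
noncomputable def freeSum (σ : ℕ → Bool) (x : ℝ) (n : ℕ) : ℝ :=
  ∑ K ∈ admissibleSets σ n, if Blocked σ K n then 0 else x ^ K.card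

open Classical in
/-- The generating function of the admissible sets that block the rung `n`. -/
noncomputable def blockedSum (σ : ℕ → Bool) (x : ℝ) (n : ℕ) : ℝ :=
  ∑ K ∈ admissibleSets σ n, if Blocked σ K n then x ^ K.card else 0

lemma freeSum_add_blockedSum (σ : ℕ → Bool) (x : ℝ) (n : ℕ) :
    freeSum σ x n + blockedSum σ x n = ∑ K ∈ admissibleSets σ n, x ^ K.card := by
  rw [freeSum, blockedSum, ← Finset.sum_add_distrib]
  refine Finset.sum_congr rfl fun K _ => ?_
  split_ifs <;> simp

lemma freeSum_zero (σ : ℕ → Bool) (x : ℝ) : freeSum σ x 0 = 1 := by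
  simp [freeSum, admissibleSets, Finset.filter_singleton, Admissible, Blocked]

lemma blockedSum_zero (σ : ℕ → Bool) (x : ℝ) : blockedSum σ x 0 = 0 := by
  simp [blockedSum, Blocked]

lemma notMem_of_mem_admissibleSets (hK : K ∈ admissibleSets σ n) : n ∉ K :=
  fun h => lt_irrefl _ ((mem_admissibleSets.1 hK).1 n h)

lemma blocked_insert_succ : Blocked σ (insert n K) (n + 1) :=
  Or.inl (Finset.mem_insert_self n K)

lemma blocked_succ_of_mem (hK : K ∈ admissibleSets σ n) :
    Blocked σ K (n + 1) ↔ Blocked σ K n ∧ σ n = σ (n + 1) :=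
  or_iff_right (notMem_of_mem_admissibleSets hK)

lemma sum_insert_eq (x : ℝ) : (∑ K ∈ admissibleSets σ n, open Classical in
    if Blocked σ K n then 0 else x ^ (insert n K).card) = x * freeSum σ x n := by
  rw [freeSum, Finset.mul_sum]
  refine Finset.sum_congr rfl fun K hK => ?_
  rw [Finset.card_insert_of_notMem (notMem_of_mem_admissibleSets hK)]
  split_ifs
  · simp
  · ring

lemma freeSum_linear (x : ℝ) (h : σ n = σ (n + 1)) : freeSum σ x (n + 1) = freeSum σ x n := by
  classical
  rw [freeSum, sum_admissibleSets_succ]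
  simp only [blocked_insert_succ, if_true, ite_self, Finset.sum_const_zero, add_zero]
  exact Finset.sum_congr rfl fun K hK => by simp [blocked_succ_of_mem hK, h]

lemma blockedSum_linear (x : ℝ) (h : σ n = σ (n + 1)) :
    blockedSum σ x (n + 1) = blockedSum σ x n + x * freeSum σ x n := by
  classical
  rw [blockedSum, sum_admissibleSets_succ, ← sum_insert_eq]
  simp only [blocked_insert_succ, if_true]
  congr 1
  exact Finset.sum_congr rfl fun K hK => by simp [blocked_succ_of_mem hK, h]

lemma freeSum_kink (x : ℝ) (h : σ n ≠ σ (n + 1)) :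
    freeSum σ x (n + 1) = freeSum σ x n + blockedSum σ x n := by
  classical
  rw [freeSum, sum_admissibleSets_succ, freeSum_add_blockedSum]
  simp only [blocked_insert_succ, if_true, ite_self, Finset.sum_const_zero, add_zero]
  exact Finset.sum_congr rfl fun K hK => by simp [blocked_succ_of_mem hK, h]

lemma blockedSum_kink (x : ℝ) (h : σ n ≠ σ (n + 1)) :
    blockedSum σ x (n + 1) = x * freeSum σ x n := by
  classical
  rw [blockedSum, sum_admissibleSets_succ, ← sum_insert_eq]
  simp only [blocked_insert_succ, if_true]
  rw [add_eq_right]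
  exact Finset.sum_eq_zero fun K hK => by simp [blocked_succ_of_mem hK, h]

end

/-! ### Zigzags with segments of equal length -/

/-- The word of the zigzag in which `a` linear hexagons and one kink alternate. -/
def zigzag (a i : ℕ) : Bool := decide (i / (a + 1) % 2 = 1)

lemma zigzag_eq_iff (a i : ℕ) : zigzag a i = zigzag a (i + 1) ↔ ¬ (a + 1) ∣ (i + 1) := by
  rw [zigzag, zigzag, decide_eq_decide, Nat.succ_div]
  split_ifs with h
  · simp only [h, not_true_eq_false, iff_false]
    omega
  · simp [h]

section
variable {a : ℕ} (x : ℝ)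

lemma zigzag_segment (b j : ℕ) (hj : j ≤ a) :
    freeSum (zigzag a) x (b * (a + 1) + j) = freeSum (zigzag a) x (b * (a + 1)) ∧
    blockedSum (zigzag a) x (b * (a + 1) + j) = blockedSum (zigzag a) x (b * (a + 1)) +
      j * x * freeSum (zigzag a) x (b * (a + 1)) := by
  induction j with
  | zero => simp
  | succ j ih =>
    obtain ⟨h1, h2⟩ := ih (by omega)
    have hlin : zigzag a (b * (a + 1) + j) = zigzag a (b * (a + 1) + j + 1) := by
      rw [zigzag_eq_iff, add_assoc, Nat.dvd_add_right (Dvd.intro_left b rfl)]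
      exact Nat.not_dvd_of_pos_of_lt (by omega) (by omega)
    rw [← add_assoc, freeSum_linear x hlin, blockedSum_linear x hlin, h1, h2]
    refine ⟨rfl, ?_⟩
    push_cast
    ring

lemma zigzag_kink (b : ℕ) :
    zigzag a (b * (a + 1) + a) ≠ zigzag a (b * (a + 1) + a + 1) := by
  rw [Ne, zigzag_eq_iff, not_not]
  exact ⟨b + 1, by ring⟩

lemma freeSum_zigzag_succ (b : ℕ) : freeSum (zigzag a) x ((b + 1) * (a + 1)) =
    (1 + a * x) * freeSum (zigzag a) x (b * (a + 1)) +
      blockedSum (zigzag a) x (b * (a + 1)) := by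
  obtain ⟨h1, h2⟩ := zigzag_segment x b a le_rfl
  rw [show (b + 1) * (a + 1) = b * (a + 1) + a + 1 by ring, freeSum_kink x (zigzag_kink b), h1, h2]
  ring

lemma blockedSum_zigzag_succ (b : ℕ) : blockedSum (zigzag a) x ((b + 1) * (a + 1)) =
    x * freeSum (zigzag a) x (b * (a + 1)) := by
  rw [show (b + 1) * (a + 1) = b * (a + 1) + a + 1 by ring, blockedSum_kink x (zigzag_kink b),
    (zigzag_segment x b a le_rfl).1]

end

/-- Up to the powers of `s`, the sextet polynomials of zigzags are Chebyshev polynomials of the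
second kind in `cos θ = (1 - a s ^ 2) / (2 s)`. -/
lemma sin_mul_freeSum_zigzag {a : ℕ} {s θ : ℝ} (h : 1 - a * s ^ 2 = 2 * s * Real.cos θ) (b : ℕ) :
    Real.sin θ * freeSum (zigzag a) (-s ^ 2) (b * (a + 1)) = s ^ b * Real.sin ((b + 1) * θ) ∧
    Real.sin θ * blockedSum (zigzag a) (-s ^ 2) (b * (a + 1)) =
      -(s ^ (b + 1) * Real.sin (b * θ)) := by
  induction b with
  | zero => simp [freeSum_zero, blockedSum_zero]
  | succ b ih =>
    obtain ⟨h1, h2⟩ := ih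
    rw [freeSum_zigzag_succ, blockedSum_zigzag_succ]
    push_cast
    constructor
    · have e1 : Real.sin ((b + 1 + 1) * θ) =
          2 * Real.cos θ * Real.sin ((b + 1) * θ) - Real.sin (b * θ) := by
        rw [show ((b : ℝ) + 1 + 1) * θ = (b + 1) * θ + θ by ring,
          show (b : ℝ) * θ = (b + 1) * θ - θ by ring, Real.sin_add, Real.sin_sub]
        ring
      rw [e1]
      linear_combination (1 - a * s ^ 2) * h1 + h2 + s ^ b * Real.sin ((b + 1) * θ) * h
    · linear_combination -s ^ 2 * h1

lemma isRealSextetZero_of_sin_eq_zero {a m : ℕ} {s θ : ℝ} (hm : 2 ≤ m)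
    (h : 1 - a * s ^ 2 = 2 * s * Real.cos θ) (h0 : Real.sin θ ≠ 0)
    (hsin : Real.sin ((m + 1) * θ) = 0) : IsRealSextetZero (-s ^ 2) := by
  obtain ⟨b, rfl⟩ : ∃ b, m = b + 1 := Nat.exists_eq_add_of_le' (by omega)
  have hn : 1 ≤ b * (a + 1) + a := by nlinarith
  have hkink := zigzag_kink (a := a) b
  refine ⟨_, chain (zigzag a) (b * (a + 1) + a), chainPos _ _, chain_isHexagonalSystem _ hn,
    chain_exists_isPerfectMatching hkink, ?_⟩
  rw [Polynomial.IsRoot, eval_sextetPolynomial_chain hkink, ← freeSum_add_blockedSum,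
    ← freeSum_kink _ hkink, show b * (a + 1) + a + 1 = (b + 1) * (a + 1) by ring]
  have := (sin_mul_freeSum_zigzag h (b + 1)).1
  rw [hsin, mul_zero] at this
  exact (mul_eq_zero.1 this).resolve_left h0

/-! ### Density -/

/-- Every negative number is of the form `-s ^ 2` with `1 - a s ^ 2 = 2 s cos θ` for suitable `a`
and `θ`. Solved for `s`, this makes `-s ^ 2` a continuous function of `θ`, and rational multiples
of `π` give zeros of sextet polynomials. -/
lemma mem_closure_of_neg {x : ℝ} (hx : x < 0) : x ∈ closure {r : ℝ | IsRealSextetZero r} := by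
  obtain ⟨s, hs, rfl⟩ : ∃ s : ℝ, 0 < s ∧ x = -s ^ 2 :=
    ⟨√(-x), Real.sqrt_pos.2 (by linarith), by rw [Real.sq_sqrt (by linarith)]; ring⟩
  set a : ℕ := ⌊1 / s ^ 2⌋₊ with ha
  have ha1 : a * s ^ 2 ≤ 1 := by
    rw [← le_div_iff₀ (by positivity)]
    exact Nat.floor_le (by positivity)
  have ha2 : 1 < (a + 1) * s ^ 2 := by
    rw [← div_lt_iff₀ (by positivity)]
    exact Nat.lt_floor_add_one _
  have hlt : 1 - a * s ^ 2 < 2 * s := by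
    by_cases h2 : s < 2
    · nlinarith
    · nlinarith [Nat.cast_nonneg (α := ℝ) a, sq_nonneg s]
  set t : ℝ := (1 - a * s ^ 2) / (2 * s) with ht
  have ht0 : 0 ≤ t := div_nonneg (by linarith) (by linarith)
  have ht1 : t < 1 := (div_lt_one (by linarith)).2 hlt
  have hts : 1 - a * s ^ 2 = 2 * s * t := by rw [ht]; field_simp
  -- The positive root of `a s ^ 2 + 2 t s - 1`, in a form that includes `a = 0`.
  set S : ℝ → ℝ := fun θ => 1 / (Real.cos θ + √(Real.cos θ ^ 2 + a)) with hS
  have hsqrt : √(t ^ 2 + a) = 1 / s - t := by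
    rw [show t ^ 2 + a = (1 / s - t) ^ 2 by field_simp; nlinarith]
    refine Real.sqrt_sq ?_
    rw [sub_nonneg, le_div_iff₀ hs]
    nlinarith [Nat.cast_nonneg (α := ℝ) a, sq_nonneg s]
  have hcos : Real.cos (Real.arccos t) = t := Real.cos_arccos (by linarith) ht1.le
  have hS0 : S (Real.arccos t) = s := by
    simp only [hS, hcos, hsqrt]
    field_simp
    ring
  have hden : Continuous fun θ => Real.cos θ + √(Real.cos θ ^ 2 + a) := by fun_prop
  have hden0 : 0 < Real.cos (Real.arccos t) + √(Real.cos (Real.arccos t) ^ 2 + a) := by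
    rw [hcos, hsqrt]
    have := one_div_pos.2 hs
    linarith
  have hcont : ContinuousAt (fun θ => -S θ ^ 2) (Real.arccos t) :=
    ((continuousAt_const.div hden.continuousAt hden0.ne').pow 2).neg
  rw [mem_closure_iff_nhds]
  intro U hU
  have hU' : ∀ᶠ θ in nhds (Real.arccos t), -S θ ^ 2 ∈ U := by
    apply hcont.eventually_mem
    rwa [hS0]
  have h1 : ∀ᶠ θ in nhds (Real.arccos t), 0 < Real.cos θ + √(Real.cos θ ^ 2 + a) :=
    hden.continuousAt.eventually_const_lt hden0
  have h2 : ∀ᶠ θ in nhds (Real.arccos t), 0 < θ ∧ θ < Real.pi :=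
    Ioo_mem_nhds (Real.arccos_pos.2 ht1) (by
      have := Real.arccos_le_pi_div_two.2 ht0
      linarith [Real.pi_pos])
  have hdense : Dense (Set.range fun q : ℚ => Real.pi * (q : ℝ)) := by
    have hsurj : Function.Surjective fun y : ℝ => Real.pi * y := fun y =>
      ⟨y / Real.pi, mul_div_cancel₀ y Real.pi_ne_zero⟩
    exact hsurj.denseRange.comp Rat.denseRange_cast (by fun_prop)
  obtain ⟨V, hV, hVo, hmem⟩ := eventually_nhds_iff.1 (hU'.and (h1.and h2))
  obtain ⟨_, hθV, q, rfl⟩ := hdense.inter_open_nonempty V hVo ⟨_, hmem⟩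
  obtain ⟨hqU, hqd, hq0, hqπ⟩ := hV _ hθV
  have hq := q.den_pos
  refine ⟨_, hqU, isRealSextetZero_of_sin_eq_zero (a := a) (m := 3 * q.den - 1)
    (θ := Real.pi * q) (by omega) ?_ (Real.sin_pos_of_pos_of_lt_pi hq0 hqπ).ne' ?_⟩
  · have hsq : √(Real.cos (Real.pi * q) ^ 2 + a) ^ 2 = Real.cos (Real.pi * q) ^ 2 + a :=
      Real.sq_sqrt (by positivity)
    simp only [hS]
    field_simp
    linear_combination hsq
  · have hcast : ((3 * q.den - 1 : ℕ) : ℝ) + 1 = 3 * q.den := by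
      rw [Nat.cast_sub (by omega)]
      push_cast
      ring
    have hden' : (q.den : ℝ) * q = q.num := by exact_mod_cast Rat.den_mul_eq_num q
    rw [hcast, show 3 * (q.den : ℝ) * (Real.pi * q) = ((3 * q.num : ℤ) : ℝ) * Real.pi by
      push_cast; linear_combination 3 * Real.pi * hden']
    exact Real.sin_int_mul_pi _

end SextetZeros

theorem mainTheorem4 :
    closure {r : ℝ | SextetZeros.IsRealSextetZero r} = Set.Iic (0 : ℝ) := by
  refine Set.Subset.antisymm
    (closure_minimal (fun r hr => SextetZeros.IsRealSextetZero.nonpos hr) isClosed_Iic) ?_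
  rw [← closure_Iio' ⟨(-1 : ℝ), by norm_num⟩]
  exact closure_minimal (fun x hx => SextetZeros.mem_closure_of_neg hx) isClosed_closure
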